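/- All fields have characteristic $\neq 2$ and all quadratic forms are regular (nondegenerate), unless they occur in a system of forms. Definitions. For an integer $i \ge 0$, a field $\ell$ of characteristic $\ne 2$ satisfies property $\mathscr{A}_i(2)$ if every system of $s$ quadratic forms over $\ell$ in $n > s\cdot 2^i$ common variables has a nontrivial simultaneous zero in an extension field of $\ell$ of odd degree. Let $L/\ell$ be a finitely generated field extension. A normal model of $L/\ell$ is a normal $\ell$-variety with function field $L$; a discrete valuation on $L$, trivial on $\ell$, is divisorial if it is equivalent to the discrete valuation induced by a prime divisor on some normal model of $L/\ell$. A set $V$ of non-trivial discrete valuations on $L$ satisfies the finite support property if for every $a \in L^\times$ the set $\{v \in V : v(a) \neq 0\}$ is finite. A quadratic form $q$ over $L$ violates the Hasse principle for isotropy with respect to $V$ if $q$ is isotropic over the $v$-adic completion $L_v$ for all $v \in V$ but $q$ is anisotropic over $L$. Statement. Let $\ell$ be a field of characteristic $\ne 2$ such that $\ell \in \mathscr{A}_i(2)$ for some $i \geq 0$, and let $L$ be a finitely generated field extension of transcendence degree $r \geq 1$ over $\ell$ such that $i + r \geq 2$. Let $V$ be a non-empty set of non-trivial divisorial discrete valuations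 on $L$, trivial on $\ell$, that satisfies the finite support property, and suppose there exists a $2^{i+r}$-dimensional quadratic form over $L$ that violates the Hasse principle for isotropy with respect to $V$. Then for any integer $m$ such that \[ 2^{i+r-1} + 2 \leq m \leq 2^{i+r}, \] there exists an $m$-dimensional quadratic form over $L$ that violates the Hasse principle for isotropy with respect to $V$. -/

import Mathlib

open AlgebraicGeometry CategoryTheory
open scoped TensorProduct WithZero

universe u w

/-!
### Quadratic forms over fields of characteristic different from two

An `n`-dimensional quadratic form over a field `k` is a `QuadraticForm k (Fin n → k)`.  All fields
to which the definitions are applied have characteristic `≠ 2`.  Mathlib's base change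
`QuadraticForm.baseChange` of quadratic forms takes the inverse of `2` as an instance argument; the
quantifiers `∃ (_ : Invertible 2)` below do nothing but supply it (such an inverse is unique, and
it exists exactly in characteristic `≠ 2`).
-/

/-- For a quadratic form `q` over `k` and a field extension `E` of `k`: the form `q_E` is
isotropic, that is, has a nontrivial zero. -/
def IsIsotropicOver {k : Type u} [Field k] {n : ℕ} (q : QuadraticForm k (Fin n → k))
    (E : Type w) [Field E] [Algebra k E] : Prop :=
  ∃ (_ : Invertible (2 : k)) (_ : Invertible (2 : E)), ¬ (q.baseChange E).Anisotropic

/-- Property `𝒜_i(2)` of a field `ℓ` of characteristic `≠ 2`: every system of `s` quadratic forms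
over `ℓ` (not necessarily regular) in `n > s * 2 ^ i` common variables has a nontrivial
simultaneous zero in an extension field of `ℓ` of odd degree. -/
def PropertyA (i : ℕ) (ℓ : Type u) [Field ℓ] : Prop :=
  ∃ (_ : Invertible (2 : ℓ)), ∀ (s n : ℕ), s * 2 ^ i < n →
    ∀ Q : Fin s → QuadraticForm ℓ (Fin n → ℓ),
      ∃ (E : Type u) (_ : Field E) (_ : Algebra ℓ E) (_ : Invertible (2 : E)),
        Odd (Module.finrank ℓ E) ∧
          ∃ x : E ⊗[ℓ] (Fin n → ℓ), x ≠ 0 ∧ ∀ j : Fin s, (Q j).baseChange E x = 0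

/-!
### Discrete valuations and the Hasse principle

A discrete valuation on a field `K` is a valuation with values in `ℤᵐ⁰`, the multiplicative
notation for `ℤ ∪ {∞}`: the additive condition `v a = 0` becomes `v a = 1`.
-/

/-- The completion `K_v` as a field extension of `K`, through the canonical map `K → K_v`. -/
noncomputable instance completionAlgebra {K : Type w} [Field K] (v : Valuation K ℤᵐ⁰) :
    Algebra K v.Completion :=
  ((algebraMap (WithVal v) v.Completion).comp
    ((WithVal.equiv v).symm : K →+* WithVal v)).toAlgebra

/-- The regular quadratic form `q` over `K` violates the Hasse principle for isotropy with respect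
to the set `V` of discrete valuations: it is isotropic over the completion `K_v` for all `v ∈ V`,
but it is anisotropic over `K`. -/
def ViolatesHassePrinciple {K : Type w} [Field K] (V : Set (Valuation K ℤᵐ⁰)) {n : ℕ}
    (q : QuadraticForm K (Fin n → K)) : Prop :=
  q.Nondegenerate ∧ (∀ v ∈ V, IsIsotropicOver q v.Completion) ∧ q.Anisotropic

/-- Finite support property: for each `a ≠ 0` only finitely many `v ∈ V` have `v(a) ≠ 0`
(multiplicatively, `v a ≠ 1`). -/
def FiniteSupportProperty {K : Type w} [Field K] (V : Set (Valuation K ℤᵐ⁰)) : Prop :=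
  ∀ a : K, a ≠ 0 → {v ∈ V | v a ≠ 1}.Finite

/-!
### Normal models and divisorial valuations
-/

/-- A normal model of a field extension `K / k`: a normal `k`-variety (an integral separated scheme
of finite type over `k` whose local rings are integrally closed) together with a `k`-isomorphism of
its function field with `K`. -/
structure NormalModel (k : Type u) (K : Type w) [Field k] [Field K] [Algebra k K] where
  /-- the variety -/
  X : Scheme.{u}
  /-- its structure morphism -/
  str : X ⟶ Spec (.of k)
  [isIntegral : IsIntegral X]
  [isSeparated : IsSeparated str]
  [locallyOfFiniteType : LocallyOfFiniteType str]
  [quasiCompact : QuasiCompact str]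
  /-- `X` is normal -/
  normal : ∀ x : X, IsIntegrallyClosed (X.presheaf.stalk x)
  /-- the identification of the function field with `K` -/
  iso : X.functionField ≃+* K
  /-- the identification is one of extensions of `k`: the inclusion of the generic point of `X`
  followed by the structure morphism is given by `k → K ≃ k(X)` -/
  iso_comp : X.fromSpecStalk (genericPoint X) ≫ str =
    Spec.map (CommRingCat.ofHom ((iso.symm : K →+* X.functionField).comp (algebraMap k K)))

attribute [instance] NormalModel.isIntegral NormalModel.isSeparated
  NormalModel.locallyOfFiniteType NormalModel.quasiCompact

namespace NormalModel

variable {k : Type u} {K : Type w} [Field k] [Field K] [Algebra k K]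

/-- The local ring of a normal model at a point of codimension one is a discrete valuation ring. -/
theorem isDiscreteValuationRing_stalk (M : NormalModel k K) (x : M.X)
    (hx : Order.coheight x = 1) : IsDiscreteValuationRing (M.X.presheaf.stalk x) := by
  have : IsLocallyNoetherian M.X := LocallyOfFiniteType.isLocallyNoetherian M.str
  have hdim : ringKrullDim (M.X.presheaf.stalk x) = 1 := by
    rw [ringKrullDim_stalk_eq_coheight, hx]; rfl
  have : IsIntegrallyClosed (M.X.presheaf.stalk x) := M.normal x
  have : Ring.KrullDimLE 1 (M.X.presheaf.stalk x) := krullDimLE_of_coheight_le hx.le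
  have hfield : ¬ IsField (M.X.presheaf.stalk x) := by
    intro h
    rw [ringKrullDim_eq_zero_of_isField h] at hdim
    exact zero_ne_one hdim
  have hdim₁ : Ring.DimensionLEOne (M.X.presheaf.stalk x) :=
    ⟨fun {p} hp hpp => Ring.krullDimLE_one_iff_of_isPrime_bot.mp ‹_› p hp hpp⟩
  have : IsDedekindDomain (M.X.presheaf.stalk x) := { toDimensionLEOne := hdim₁ }
  exact ((IsDiscreteValuationRing.TFAE (M.X.presheaf.stalk x) hfield).out 2 0).mp this

/-- The discrete valuation on `K` induced by a prime divisor `D` on a normal model.  The prime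
divisor is given by its generic point `x`, a point of codimension one; the valuation is the
valuation of the discrete valuation ring `𝒪_{X,x}`, whose fraction field is the function field. -/
noncomputable def divisorValuation (M : NormalModel k K) (x : M.X)
    (hx : Order.coheight x = 1) : Valuation K ℤᵐ⁰ :=
  haveI := M.isDiscreteValuationRing_stalk x hx
  ((IsDiscreteValuationRing.maximalIdeal (M.X.presheaf.stalk x)).valuation
    M.X.functionField).comap (M.iso.symm : K →+* M.X.functionField)

end NormalModel

/-- A discrete valuation on `K` is divisorial (with respect to `K / k`) if it is trivial on `k` and
equivalent to the valuation induced by some prime divisor on some normal model of `K / k`. -/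
def IsDivisorial (k : Type u) {K : Type w} [Field k] [Field K] [Algebra k K]
    (v : Valuation K ℤᵐ⁰) : Prop :=
  v.IsTrivialOn k ∧ ∃ (M : NormalModel k K) (x : M.X) (hx : Order.coheight x = 1),
    v.IsEquiv (M.divisorValuation x hx)

/-! Put N = 2^(i+r-1). The first input is the bound u(L) ≤ 2N (`PropertyA.diagonalIsotropicAbove`).
Tsen–Lang counting gives zeros over E[X_1, ..., X_m] with [E : ℓ] odd, and Springer's theorem
(`anisotropic_of_odd_finrank`) brings them down to ℓ[X_1, ..., X_m]. The bound is carried for all m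
at once, so that a simple algebraic extension k[X]/(f) can be treated as a residue ring of k[X],
where the bound halves.

Diagonalize the given 2N-dimensional form as σ ⊥ ρ with dim σ = N + 1. If all coefficients of σ are
v-units, then σ is isotropic over L_v: for v(π) not the square of a value, σ ⊥ πσ has 2N + 2
variables, hence a zero over L, and comparing values forces local isotropy of σ
(`approxIsotropic_of_units`). Finite support leaves finitely many v ∈ V. At these, isotropy of σ ⊥ ρ
gives an open condition on z, and weak approximation yields one z ≠ 0 for which σ ⊥ ⟨ρ(z)⟩ is
isotropic at all of them (`exists_ne_zero_forall_approxIsotropic`). This (N + 2)-dimensional form is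
a subform of the original one, and every form lying between the two is isotropic at each v and
anisotropic over L.

Local isotropy is handled through `ApproxIsotropic`, a strict inequality between values on L itself,
which a Hensel-type square root turns into a zero over the completion. -/

/-! ### Base change and isotropy in coordinates -/

section BaseChange

variable {k : Type*} {E : Type*} [Field k] [Field E] [Algebra k E]

/-- The base change of a quadratic form is determined by its values on the vectors `1 ⊗ m`. -/
theorem QuadraticForm.baseChange_eq_of_forall_one_tmul {M : Type*} [AddCommGroup M] [Module k M]
    [Invertible (2 : k)] [Invertible (2 : E)] (Q : QuadraticForm k M)
    (Q' : QuadraticForm E (E ⊗[k] M))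
    (h : ∀ m : M, Q' ((1 : E) ⊗ₜ[k] m) = algebraMap k E (Q m)) : Q.baseChange E = Q' := by
  -- As 2 is invertible, it suffices to compare the associated bilinear forms, which are determined
  -- on the vectors 1 ⊗ m.
  apply (QuadraticMap.associated_rightInverse E).injective
  have hQ : ∀ m : M, Q.baseChange E ((1 : E) ⊗ₜ[k] m) = algebraMap k E (Q m) := fun m => by
    rw [QuadraticForm.baseChange_tmul, Algebra.smul_def]; simp
  ext m n
  simp [QuadraticMap.associated_apply, ← TensorProduct.tmul_add, h, hQ]

theorem QuadraticForm.baseChange_comp_apply {M N : Type*} [AddCommGroup M] [Module k M]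
    [AddCommGroup N] [Module k N] [Invertible (2 : k)] [Invertible (2 : E)]
    (Q : QuadraticForm k N) (f : M →ₗ[k] N) (z : E ⊗[k] M) :
    (QuadraticForm.baseChange E (Q.comp f)) z = Q.baseChange E (f.baseChange E z) := by
  rw [QuadraticForm.baseChange_eq_of_forall_one_tmul (Q.comp f)
    ((Q.baseChange E).comp (f.baseChange E))]
  · rfl
  · intro m
    simp [Algebra.smul_def]

theorem QuadraticForm.baseChange_sum_linMulLin_apply {ι : Type*} [Fintype ι] [DecidableEq ι]
    [Invertible (2 : k)] [Invertible (2 : E)] (c : ι → ι → k) (z : E ⊗[k] (ι → k)) :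
    QuadraticForm.baseChange E (∑ p, ∑ q, c p q • QuadraticMap.linMulLin
      (LinearMap.proj (R := k) (φ := fun _ => k) p) (LinearMap.proj q)) z =
      ∑ p, ∑ q, algebraMap k E (c p q) *
        (TensorProduct.piScalarRight k E E ι z p * TensorProduct.piScalarRight k E E ι z q) := by
  rw [QuadraticForm.baseChange_eq_of_forall_one_tmul _
    ((∑ p, ∑ q, algebraMap k E (c p q) • QuadraticMap.linMulLin
      (LinearMap.proj (R := E) (φ := fun _ => E) p) (LinearMap.proj q)).comp
      (TensorProduct.piScalarRight k E E ι).toLinearMap)]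
  · simp [Algebra.smul_def]
  · intro m
    simp [Algebra.smul_def]

theorem QuadraticForm.baseChange_weightedSumSquares_apply {ι : Type*} [Fintype ι] [DecidableEq ι]
    [Invertible (2 : k)] [Invertible (2 : E)] (a : ι → k) (z : E ⊗[k] (ι → k)) :
    QuadraticForm.baseChange E (QuadraticMap.weightedSumSquares k a) z =
      ∑ p, algebraMap k E (a p) * TensorProduct.piScalarRight k E E ι z p ^ 2 := by
  rw [QuadraticForm.baseChange_eq_of_forall_one_tmul _
    ((QuadraticMap.weightedSumSquares E fun p => algebraMap k E (a p)).comp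
      (TensorProduct.piScalarRight k E E ι).toLinearMap)]
  · simp [QuadraticMap.weightedSumSquares_apply, pow_two]
  · intro m
    simp [QuadraticMap.weightedSumSquares_apply, Algebra.smul_def]

end BaseChange

/-- A diagonal form becomes isotropic over `E` iff it has a nontrivial zero with coordinates
in `E`. -/
theorem isIsotropicOver_weightedSumSquares_iff {k : Type u} [Field k] (E : Type w) [Field E]
    [Algebra k E] (h2 : (2 : k) ≠ 0) {n : ℕ} (a : Fin n → k) :
    IsIsotropicOver (QuadraticMap.weightedSumSquares k a) E ↔
      ∃ x : Fin n → E, x ≠ 0 ∧ ∑ p, algebraMap k E (a p) * x p ^ 2 = 0 := by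
  have h2E : (2 : E) ≠ 0 := by
    rw [← map_ofNat (algebraMap k E) 2]; exact (map_ne_zero _).mpr h2
  constructor
  · rintro ⟨_, _, h⟩
    simp only [QuadraticMap.Anisotropic, not_forall] at h
    obtain ⟨z, hz, hz0⟩ := h
    exact ⟨TensorProduct.piScalarRight k E E _ z, (LinearEquiv.map_ne_zero_iff _).mpr hz0,
      by rw [← QuadraticForm.baseChange_weightedSumSquares_apply, hz]⟩
  · rintro ⟨x, hx, h⟩
    refine ⟨invertibleOfNonzero h2, invertibleOfNonzero h2E, fun hani => hx ?_⟩
    let := invertibleOfNonzero h2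
    let := invertibleOfNonzero h2E
    have := hani ((TensorProduct.piScalarRight k E E _).symm x) (by
      rw [QuadraticForm.baseChange_weightedSumSquares_apply]; simpa using h)
    simpa using this

/-- If the restriction of a form along an injective linear map is isotropic over `E`, then so is
the form. -/
theorem IsIsotropicOver.of_comp {k : Type u} [Field k] {E : Type w} [Field E]
    [Algebra k E] {m n : ℕ} {q : QuadraticForm k (Fin n → k)}
    (f : (Fin m → k) →ₗ[k] (Fin n → k)) (hf : Function.Injective f)
    (h : IsIsotropicOver (q.comp f) E) : IsIsotropicOver q E := by
  obtain ⟨i₁, i₂, h⟩ := h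
  refine ⟨i₁, i₂, fun hani => h fun z hz => ?_⟩
  rw [QuadraticForm.baseChange_comp_apply] at hz
  have hinj : Function.Injective (f.baseChange E) :=
    Module.Flat.lTensor_preserves_injective_linearMap (M := E) f hf
  exact hinj ((hani _ hz).trans (map_zero _).symm)

/-! ### Bounds of u-invariant type: fractions and residue rings -/

/-- Every diagonal quadratic form over `R` in more than `n` variables has a nontrivial zero. For a
field of characteristic different from two this says that its `u`-invariant is at most `n`. -/
def DiagonalIsotropicAbove (R : Type*) [CommRing R] (n : ℕ) : Prop :=
  ∀ (ι : Type) [Fintype ι], n < Fintype.card ι → ∀ a : ι → R,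
    ∃ x : ι → R, x ≠ 0 ∧ ∑ k, a k * x k ^ 2 = 0

theorem DiagonalIsotropicAbove.of_ringEquiv {R S : Type*} [CommRing R] [CommRing S] {n : ℕ}
    (h : DiagonalIsotropicAbove R n) (e : R ≃+* S) : DiagonalIsotropicAbove S n := by
  intro ι _ hn a
  obtain ⟨x, hx, h0⟩ := h ι hn fun k => e.symm (a k)
  refine ⟨fun k => e (x k), fun h => hx ?_, ?_⟩
  · ext k
    simpa using congrFun h k
  · simpa using congrArg e h0

/-- Passage from a ring to a ring of fractions. -/
theorem DiagonalIsotropicAbove.of_isLocalization {R S : Type*} [CommRing R] [CommRing S]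
    [Algebra R S] (M : Submonoid R) [IsLocalization M S]
    (hinj : Function.Injective (algebraMap R S)) {n : ℕ}
    (h : DiagonalIsotropicAbove R n) : DiagonalIsotropicAbove S n := by
  intro ι _ hn a
  obtain ⟨b, hb⟩ := IsLocalization.exist_integer_multiples_of_finite M a
  choose c hc using hb
  obtain ⟨x, hx, h0⟩ := h ι hn c
  refine ⟨fun k => algebraMap R S (x k), fun h => hx ?_, ?_⟩
  · ext k
    exact hinj (by simpa using congrFun h k)
  · apply (IsLocalization.map_units S b).mul_left_cancel
    have := congrArg (algebraMap R S) h0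
    rw [map_sum] at this
    rw [mul_zero, Finset.mul_sum, ← map_zero (algebraMap R S), ← this]
    refine Finset.sum_congr rfl fun k _ => ?_
    rw [map_mul, map_pow, hc, Algebra.smul_def, mul_assoc]

/-- A nontrivial zero over the fraction field yields one over the ring. -/
theorem exists_zero_of_fractionRing_zero {R K : Type*} [CommRing R] [IsDomain R]
    [Field K] [Algebra R K] [IsFractionRing R K] {ι : Type*} [Fintype ι] (a : ι → R)
    (h : ∃ x : ι → K, x ≠ 0 ∧ ∑ k, algebraMap R K (a k) * x k ^ 2 = 0) :
    ∃ x : ι → R, x ≠ 0 ∧ ∑ k, a k * x k ^ 2 = 0 := by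
  obtain ⟨x, hx, h0⟩ := h
  obtain ⟨b, hb⟩ := IsLocalization.exist_integer_multiples_of_finite (nonZeroDivisors R) x
  choose c hc using hb
  have hb0 : algebraMap R K b ≠ 0 := IsFractionRing.to_map_ne_zero_of_mem_nonZeroDivisors b.2
  refine ⟨c, fun h => hx ?_, IsFractionRing.injective R K ?_⟩
  · ext k
    have := hc k
    rw [h, Algebra.smul_def] at this
    simpa [hb0] using this
  · rw [map_zero, map_sum, ← mul_zero (algebraMap R K b ^ 2), ← h0, Finset.mul_sum]
    refine Finset.sum_congr rfl fun k _ => ?_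
    rw [map_mul, map_pow, hc, Algebra.smul_def]
    ring

/-- A zero may be divided by p while p divides all its coordinates; this stops because a nonzero
coordinate has finite multiplicity at p. -/
theorem exists_not_dvd_of_sum_mul_sq_eq_zero {R : Type*} [CommRing R] [IsDomain R] [WfDvdMonoid R]
    {p : R} (hp : Prime p) {ι : Type*} [Fintype ι] (a : ι → R)
    (h : ∃ x : ι → R, x ≠ 0 ∧ ∑ k, a k * x k ^ 2 = 0) :
    ∃ x : ι → R, (∃ j, ¬ p ∣ x j) ∧ ∑ k, a k * x k ^ 2 = 0 := by
  obtain ⟨x, hx, h0⟩ := h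
  obtain ⟨j, hj⟩ := Function.ne_iff.mp hx
  obtain ⟨n, hn⟩ := FiniteMultiplicity.of_prime_left hp hj
  replace hn : ∃ j, ¬ p ^ (n + 1) ∣ x j := ⟨j, hn⟩
  clear hx hj j
  generalize n + 1 = N at hn
  induction N generalizing x with
  | zero => simp at hn
  | succ N ih =>
    by_cases hall : ∃ i, ¬ p ∣ x i
    · exact ⟨x, hall, h0⟩
    push Not at hall
    choose y hy using hall
    obtain rfl : x = fun k => p * y k := funext hy
    refine ih y ?_ ?_
    · apply mul_left_cancel₀ (pow_ne_zero 2 hp.ne_zero)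
      rw [mul_zero, ← h0, Finset.mul_sum]
      exact Finset.sum_congr rfl fun k _ => by ring
    · obtain ⟨j, hj⟩ := hn
      refine ⟨j, fun h => hj ?_⟩
      rw [pow_succ']
      exact mul_dvd_mul_left p h

/-- Passage to the residue ring at a prime element halves the bound. -/
theorem DiagonalIsotropicAbove.residue {R S : Type*} [CommRing R] [IsDomain R] [WfDvdMonoid R]
    [CommRing S] {p : R} (hp : Prime p) (φ : R →+* S) (hφ : Function.Surjective φ)
    (hker : ∀ x, φ x = 0 ↔ p ∣ x) {n : ℕ} (h : DiagonalIsotropicAbove R (2 * n)) :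
    DiagonalIsotropicAbove S n := by
  intro ι _ hn a
  choose b hb using fun k => hφ (a k)
  -- Lift the form to b and use a zero of b ⊥ pb. If p does not divide the first half, reduce mod p;
  -- otherwise divide the relation by p, and the second half reduces to a zero.
  obtain ⟨x, ⟨j, hj⟩, h0⟩ := exists_not_dvd_of_sum_mul_sq_eq_zero hp _
    (h (ι ⊕ ι) (by simp; omega) (Sum.elim b fun k => p * b k))
  simp only [Fintype.sum_sum_type, Sum.elim_inl, Sum.elim_inr] at h0
  by_cases hx : ∃ k, ¬ p ∣ x (Sum.inl k)
  · obtain ⟨k, hk⟩ := hx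
    refine ⟨fun k => φ (x (Sum.inl k)), fun h => hk ((hker _).mp (congrFun h k)), ?_⟩
    have hφp : φ p = 0 := (hker p).mpr dvd_rfl
    simpa [hb, hφp] using congrArg φ h0
  · push Not at hx
    choose y hy using hx
    have hj' : ∃ k, ¬ p ∣ x (Sum.inr k) := by
      rcases j with j | j
      · exact absurd ⟨y j, hy j⟩ hj
      · exact ⟨j, hj⟩
    obtain ⟨k, hk⟩ := hj'
    refine ⟨fun k => φ (x (Sum.inr k)), fun h => hk ((hker _).mp (congrFun h k)), ?_⟩
    have h1 : p * (∑ k, b k * y k ^ 2) + ∑ k, b k * x (Sum.inr k) ^ 2 = 0 := by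
      apply mul_left_cancel₀ hp.ne_zero
      rw [mul_zero, ← h0, mul_add, Finset.mul_sum, Finset.mul_sum, Finset.mul_sum]
      congr 1
      · exact Finset.sum_congr rfl fun k _ => by rw [hy]; ring
      · exact Finset.sum_congr rfl fun k _ => by ring
    have hφp : φ p = 0 := (hker p).mpr dvd_rfl
    simpa [hb, hφp] using congrArg φ h1

/-! ### Polynomial rings and field extensions -/

/-- Every polynomial ring in `m` variables over `k` satisfies `u ≤ 2 ^ (j + m)`. -/
def PolynomialDiagonalIsotropic (k : Type*) [CommRing k] (j : ℕ) : Prop :=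
  ∀ m : ℕ, DiagonalIsotropicAbove (MvPolynomial (Fin m) k) (2 ^ (j + m))

theorem PolynomialDiagonalIsotropic.self {k : Type*} [CommRing k] {j : ℕ}
    (h : PolynomialDiagonalIsotropic k j) : DiagonalIsotropicAbove k (2 ^ j) :=
  (h 0).of_ringEquiv (MvPolynomial.isEmptyRingEquiv k (Fin 0))

theorem PolynomialDiagonalIsotropic.of_ringEquiv {k k' : Type*} [CommRing k] [CommRing k'] {j : ℕ}
    (h : PolynomialDiagonalIsotropic k j) (e : k ≃+* k') : PolynomialDiagonalIsotropic k' j :=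
  fun m => (h m).of_ringEquiv (MvPolynomial.mapEquiv (Fin m) e)

/-- Simple algebraic extensions. -/
theorem PolynomialDiagonalIsotropic.of_algebraic {k F : Type*} [Field k] [Field F] [Algebra k F]
    {j : ℕ} (h : PolynomialDiagonalIsotropic k j) (α : F) (hα : IsIntegral k α)
    (hgen : Function.Surjective (Polynomial.aeval (R := k) α)) :
    PolynomialDiagonalIsotropic F j := by
  intro m
  -- The extra variable doubles the bound, and passing to the residue ring at the prime `minpoly k
  -- α` halves it again.
  have hR : DiagonalIsotropicAbove (MvPolynomial (Fin m) (Polynomial k)) (2 * 2 ^ (j + m)) := by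
    rw [← pow_succ', add_assoc]
    exact (h (m + 1)).of_ringEquiv
      ((MvPolynomial.renameEquiv k (finSuccEquiv m)).trans
        (MvPolynomial.optionEquivRight k (Fin m))).toRingEquiv
  refine hR.residue (p := MvPolynomial.C (minpoly k α)) ?_
    (MvPolynomial.map (Polynomial.aeval (R := k) α).toRingHom)
    (MvPolynomial.map_surjective _ hgen) fun x => ?_
  · exact (MvPolynomial.prime_C_iff _).mpr (minpoly.prime hα)
  · rw [MvPolynomial.C_dvd_iff_dvd_coeff, MvPolynomial.eq_zero_iff]
    refine forall_congr' fun d => ?_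
    rw [MvPolynomial.coeff_map]
    exact (minpoly.dvd_iff).symm

attribute [local instance] MvPolynomial.algebraMvPolynomial in
/-- Purely transcendental extensions. -/
theorem PolynomialDiagonalIsotropic.of_isFractionRing {k F : Type*} [Field k] [Field F] {r : ℕ}
    [Algebra (MvPolynomial (Fin r) k) F] [IsFractionRing (MvPolynomial (Fin r) k) F]
    {j : ℕ} (h : PolynomialDiagonalIsotropic k j) : PolynomialDiagonalIsotropic F (j + r) := by
  intro m
  have hR : DiagonalIsotropicAbove (MvPolynomial (Fin m) (MvPolynomial (Fin r) k))
      (2 ^ (j + r + m)) := by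
    have := (h (m + r)).of_ringEquiv
      ((MvPolynomial.renameEquiv k finSumFinEquiv.symm).trans
        (MvPolynomial.sumAlgEquiv k (Fin m) (Fin r))).toRingEquiv
    rwa [show j + r + m = j + (m + r) by ring]
  refine hR.of_isLocalization
    ((nonZeroDivisors (MvPolynomial (Fin r) k)).map (MvPolynomial.C (σ := Fin m))) ?_
  rw [MvPolynomial.algebraMap_def]
  exact MvPolynomial.map_injective _ (IsFractionRing.injective _ _)

/-! ### Springer's theorem -/

section Springer

open Polynomial

theorem Polynomial.exists_irreducible_dvd_of_odd_natDegree {K : Type*} [Field K] {h : K[X]}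
    (hodd : Odd h.natDegree) : ∃ p : K[X], Irreducible p ∧ Odd p.natDegree ∧ p ∣ h := by
  have h0 : h ≠ 0 := by rintro rfl; simp at hodd
  induction h using WfDvdMonoid.induction_on_irreducible with
  | zero => exact absurd rfl h0
  | unit u hu => simp [natDegree_eq_zero_of_isUnit hu] at hodd
  | mul a i ha hi ih =>
    by_cases hiodd : Odd i.natDegree
    · exact ⟨i, hi, hiodd, dvd_mul_right i a⟩
    · rw [natDegree_mul hi.ne_zero ha, Nat.odd_add] at hodd
      obtain ⟨p, hp, hpodd, hpa⟩ := ih (by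
        by_contra hcon
        rw [Nat.not_odd_iff_even] at hcon
        exact hiodd (hodd.mpr hcon)) ha
      exact ⟨p, hp, hpodd, hpa.mul_left i⟩

/-- The degree of the value of an anisotropic diagonal form at a nonzero vector of polynomials. -/
theorem natDegree_sum_mul_sq_of_anisotropic {K : Type*} [Field K] {ι : Type*} [Fintype ι]
    {a : ι → K} (ha : ∀ x : ι → K, ∑ k, a k * x k ^ 2 = 0 → x = 0) {z : ι → K[X]} {j : ι}
    (hj : z j ≠ 0) (hmax : ∀ k, (z k).natDegree ≤ (z j).natDegree) :
    (∑ k, C (a k) * z k ^ 2).natDegree = 2 * (z j).natDegree := by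
  refine natDegree_eq_of_le_of_coeff_ne_zero ?_ ?_
  · refine natDegree_sum_le_of_forall_le _ _ fun k _ => ?_
    exact (natDegree_C_mul_le _ _).trans (natDegree_pow_le_of_le 2 (hmax k))
  -- The coefficient in degree 2 deg z_j is the form evaluated at the coefficients of degree deg
  -- z_j, a vector with nonzero j-th entry.
  · have hc : (∑ k, C (a k) * z k ^ 2).coeff (2 * (z j).natDegree) =
        ∑ k, a k * (z k).coeff (z j).natDegree ^ 2 := by
      rw [finsetSum_coeff]
      refine Finset.sum_congr rfl fun k _ => ?_
      rw [coeff_C_mul, coeff_pow_of_natDegree_le (hmax k)]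
    rw [hc]
    intro h
    exact hj (leadingCoeff_eq_zero.mp (congrFun (ha _ h) j))

/-- Descent on deg f, the heart of Springer's theorem. If some x_k is not divisible by f, reducing x
mod f and removing the gcd leaves a primitive vector z of degree below deg f whose value is fh.
Anisotropy makes the degree of this value even and less than 2 deg f, so h has an irreducible factor
p of odd degree below deg f. By induction p divides every z_k, against primitivity. -/
theorem Polynomial.dvd_of_dvd_sum_mul_sq_of_anisotropic {K : Type*} [Field K] {ι : Type*}
    [Fintype ι] {a : ι → K} (ha : ∀ x : ι → K, ∑ k, a k * x k ^ 2 = 0 → x = 0)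
    {f : K[X]} (hf : Irreducible f) (hodd : Odd f.natDegree) {x : ι → K[X]}
    (hx : f ∣ ∑ k, C (a k) * x k ^ 2) (k : ι) : f ∣ x k := by
  classical
  induction hd : f.natDegree using Nat.strong_induction_on generalizing f x k with
  | _ d IH =>
  by_contra hk
  let : NormalizedGCDMonoid K[X] := UniqueFactorizationMonoid.toNormalizedGCDMonoid _
  obtain ⟨z, hz, hgcd⟩ := Finset.extract_gcd (s := Finset.univ) (fun k => x k % f) ⟨k, by simp⟩
  set g := Finset.univ.gcd fun k => x k % f with hg
  have hyk : x k % f ≠ 0 := fun h => hk ((EuclideanDomain.mod_eq_zero).mp h)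
  have hgz : g ≠ 0 ∧ z k ≠ 0 := by
    rw [hz k (by simp)] at hyk
    exact ⟨left_ne_zero_of_mul hyk, right_ne_zero_of_mul hyk⟩
  have hzdeg : ∀ k, z k ≠ 0 → g.natDegree + (z k).natDegree < d := by
    intro k hzk
    rw [← natDegree_mul hgz.1 hzk, ← hz k (by simp), ← hd]
    exact natDegree_mod_lt _ (by rintro h; simp [h] at hodd)
  have hfz : f ∣ ∑ k, C (a k) * z k ^ 2 := by
    have h1 : f ∣ ∑ k, C (a k) * (g * z k) ^ 2 := by
      rw [← (Ideal.Quotient.eq_zero_iff_dvd _ _), map_sum] at hx ⊢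
      rw [← hx]
      refine Finset.sum_congr rfl fun k _ => ?_
      have : Ideal.Quotient.mk (Ideal.span {f}) (g * z k) = Ideal.Quotient.mk _ (x k) := by
        rw [← hz k (by simp)]
        nth_rw 2 [← EuclideanDomain.div_add_mod (x k) f]
        rw [map_add, (Ideal.Quotient.eq_zero_iff_dvd _ _).mpr (dvd_mul_right f _), zero_add]
      rw [map_mul, map_pow, this, map_mul, map_pow]
    have h2 : ∑ k, C (a k) * (g * z k) ^ 2 = g ^ 2 * ∑ k, C (a k) * z k ^ 2 := by
      rw [Finset.mul_sum]
      exact Finset.sum_congr rfl fun k _ => by ring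
    rw [h2] at h1
    refine (hf.prime.dvd_or_dvd h1).resolve_left fun h => ?_
    have := natDegree_le_of_dvd (hf.prime.dvd_of_dvd_pow h) hgz.1
    have := hzdeg k hgz.2
    omega
  obtain ⟨j, -, hj⟩ := Finset.exists_max_image Finset.univ (fun k => (z k).natDegree) ⟨k, by simp⟩
  have hjz : ∃ j, z j ≠ 0 ∧ ∀ k, (z k).natDegree ≤ (z j).natDegree := by
    by_cases hzj : z j = 0
    · refine ⟨k, hgz.2, fun k' => ?_⟩
      have := hj k' (by simp)
      simp only [hzj, natDegree_zero] at this
      omega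
    · exact ⟨j, hzj, fun k => hj k (by simp)⟩
  obtain ⟨j, hzj, hmax⟩ := hjz
  have hdeg := natDegree_sum_mul_sq_of_anisotropic ha hzj hmax
  obtain ⟨h, hh⟩ := hfz
  have hne : ∑ k, C (a k) * z k ^ 2 ≠ 0 := by
    intro h0
    rw [h0, natDegree_zero] at hdeg
    have hcoef : ∀ k, z k = C ((z k).coeff 0) := fun k =>
      eq_C_of_natDegree_eq_zero (by have := hmax k; omega)
    have : (fun k => (z k).coeff 0) = 0 := ha _ (by
      have h0' := congrArg (fun p => coeff p 0) h0
      simpa [finsetSum_coeff, mul_coeff_zero, pow_two] using h0')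
    exact hzj (by rw [hcoef j, congrFun this j]; simp)
  have hh0 : h ≠ 0 := by rintro rfl; exact hne (by simpa using hh)
  rw [hh, natDegree_mul hf.ne_zero hh0, hd] at hdeg
  have hjd := hzdeg j hzj
  have hhodd : Odd h.natDegree := by
    rw [hd] at hodd
    obtain ⟨c, hc⟩ := hodd
    exact ⟨(z j).natDegree - c - 1, by omega⟩
  obtain ⟨p, hp, hpodd, hph⟩ := exists_irreducible_dvd_of_odd_natDegree hhodd
  have hpdeg := natDegree_le_of_dvd hph hh0
  have hpz : ∀ k, p ∣ z k := fun k =>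
    IH p.natDegree (by omega) hp hpodd (hh ▸ hph.mul_left f) k rfl
  exact hp.not_isUnit (isUnit_of_dvd_one (hgcd ▸ Finset.dvd_gcd fun k _ => hpz k))

/-- **Springer's theorem** for diagonal forms: an anisotropic form stays anisotropic over
extensions of odd degree. -/
theorem anisotropic_of_odd_finrank {K F : Type u} [Field K] [Field F] [Algebra K F]
    (hodd : Odd (Module.finrank K F)) {ι : Type*} [Fintype ι] {a : ι → K}
    (ha : ∀ x : ι → K, ∑ k, a k * x k ^ 2 = 0 → x = 0) (x : ι → F)
    (hx : ∑ k, algebraMap K F (a k) * x k ^ 2 = 0) : x = 0 := by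
  induction hn : Module.finrank K F using Nat.strong_induction_on generalizing K with
  | _ n IH =>
  have : FiniteDimensional K F := Module.finite_of_finrank_pos hodd.pos
  by_cases hsurj : Function.Surjective (algebraMap K F)
  · choose y hy using fun k => hsurj (x k)
    have hy0 := ha y ((algebraMap K F).injective (by simpa [hy] using hx))
    ext k
    simp [← hy, hy0]
  · rw [Function.Surjective] at hsurj
    push Not at hsurj
    obtain ⟨α, hα⟩ := hsurj
    have hint : IsIntegral K α := IsIntegral.of_finite K α
    have hmul := Module.finrank_mul_finrank K (IntermediateField.adjoin K {α}) F
    have hdeg := IntermediateField.adjoin.finrank hint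
    rw [← hmul, Nat.odd_mul] at hodd
    have hne1 : Module.finrank K (IntermediateField.adjoin K {α}) ≠ 1 := by
      intro h
      rw [IntermediateField.finrank_adjoin_simple_eq_one_iff, IntermediateField.mem_bot] at h
      exact h.elim hα
    have hpos := hodd.2.pos
    refine IH (Module.finrank (IntermediateField.adjoin K {α}) F) ?_ hodd.2
      (a := fun k => algebraMap K _ (a k)) ?_ ?_ rfl
    · have := hodd.1.pos
      rw [← hn, ← hmul]
      exact lt_mul_of_one_lt_left hpos (by omega)
    · intro y hy
      -- Anisotropy over K(α): write the coordinates of a zero as polynomials in α; all of these are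
      -- then divisible by the minimal polynomial.
      have hgen : ∀ y : IntermediateField.adjoin K {α}, ∃ p : K[X], aeval α p = (y : F) := by
        intro y
        obtain ⟨p, hp⟩ := (IntermediateField.adjoin.powerBasis hint).exists_eq_aeval' y
        refine ⟨p, ?_⟩
        rw [hp, IntermediateField.adjoin.powerBasis_gen]
        exact (IntermediateField.AdjoinSimple.coe_aeval_gen_apply (F := K) (α := α) p).symm
      choose p hp using fun k => hgen (y k)
      have hdvd : minpoly K α ∣ ∑ k, C (a k) * p k ^ 2 := by
        rw [minpoly.dvd_iff]
        simpa [hp] using congrArg (algebraMap (IntermediateField.adjoin K {α}) F) hy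
      ext k
      have := dvd_of_dvd_sum_mul_sq_of_anisotropic ha (minpoly.irreducible hint)
        (hdeg ▸ hodd.1) hdvd k
      rw [minpoly.dvd_iff, hp] at this
      simpa using this
    · exact hx

end Springer

/-! ### Tsen–Lang counting -/

/-- Property `𝒜_i(2)` for systems given by coefficient matrices. -/
theorem PropertyA.exists_common_zero {i : ℕ} {ℓ : Type u} [Field ℓ] (h : PropertyA i ℓ)
    {κ ι : Type*} [Fintype κ] [Fintype ι] (hcard : Fintype.card κ * 2 ^ i < Fintype.card ι)
    (c : κ → ι → ι → ℓ) :
    ∃ (E : Type u) (_ : Field E) (_ : Algebra ℓ E), Odd (Module.finrank ℓ E) ∧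
      ∃ x : ι → E, x ≠ 0 ∧ ∀ j, ∑ p, ∑ q, algebraMap ℓ E (c j p q) * (x p * x q) = 0 := by
  obtain ⟨_, h⟩ := h
  let eκ := Fintype.equivFin κ
  let eι := Fintype.equivFin ι
  obtain ⟨E, _, _, _, hodd, z, hz, h0⟩ := h _ _ hcard fun j => ∑ p, ∑ q,
    c (eκ.symm j) (eι.symm p) (eι.symm q) • QuadraticMap.linMulLin
      (LinearMap.proj (R := ℓ) (φ := fun _ => ℓ) p) (LinearMap.proj q)
  refine ⟨E, _, _, hodd, fun p => TensorProduct.piScalarRight ℓ E E _ z (eι p), fun h => ?_,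
    fun j => ?_⟩
  · refine (LinearEquiv.map_ne_zero_iff (TensorProduct.piScalarRight ℓ E E _)).mpr hz ?_
    ext p
    simpa using congrFun h (eι.symm p)
  · have := h0 (eκ j)
    rw [QuadraticForm.baseChange_sum_linMulLin_apply] at this
    rw [← this]
    refine Fintype.sum_equiv eι _ _ fun p => Fintype.sum_equiv eι _ _ fun q => ?_
    simp

/-- After division by T^m the left side tends to 2^m A as T grows. -/
theorem exists_pow_mul_lt_mul_pow {A N : ℕ} (m c : ℕ) (h : A * 2 ^ m < N) :
    ∃ T : ℕ, (2 * T + c) ^ m * A < N * T ^ m := by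
  have hlim : Filter.Tendsto (fun T : ℕ => ((2 : ℝ) + c / T) ^ m * A) Filter.atTop
      (nhds ((2 + 0) ^ m * A)) :=
    ((tendsto_const_nhds.add (tendsto_const_div_atTop_nhds_zero_nat (c : ℝ))).pow m).mul_const _
  have hlt : ((2 : ℝ) + 0) ^ m * A < N := by
    rw [add_zero, mul_comm]
    exact_mod_cast h
  obtain ⟨T, hT, hT0⟩ := ((hlim.eventually_lt_const hlt).and (Filter.eventually_gt_atTop 0)).exists
  refine ⟨T, ?_⟩
  have hTpos : (0 : ℝ) < T := by exact_mod_cast hT0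
  have hmul := mul_lt_mul_of_pos_right hT (pow_pos hTpos m)
  have heq : ((2 : ℝ) + c / T) ^ m * A * T ^ m = (2 * T + c) ^ m * A := by
    rw [mul_right_comm, ← mul_pow, add_mul, div_mul_cancel₀ _ hTpos.ne']
  rw [heq] at hmul
  exact_mod_cast hmul

section

open MvPolynomial

/-- The polynomial with coefficients `x ν` whose degree in every variable is less than `T`. -/
noncomputable def boxPolynomial {R : Type*} [CommRing R] {m T : ℕ} (x : (Fin m → Fin T) → R) :
    MvPolynomial (Fin m) R :=
  ∑ ν, monomial (Finsupp.equivFunOnFinite.symm fun s => (ν s : ℕ)) (x ν)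

theorem boxPolynomial_injective {R : Type*} [CommRing R] {m T : ℕ}
    (x : (Fin m → Fin T) → R) (h : boxPolynomial x = 0) : x = 0 := by
  classical
  ext ν
  have := congrArg (coeff (Finsupp.equivFunOnFinite.symm fun s => (ν s : ℕ))) h
  rw [boxPolynomial, coeff_sum, Finset.sum_eq_single ν] at this
  · simpa using this
  · intro ν' _ hne
    rw [coeff_monomial, if_neg]
    intro heq
    apply hne
    ext s
    exact DFunLike.congr_fun heq s
  · simp

/-- Each coefficient of a·P² is a quadratic form in the coefficients of P, defined over the base
ring; these forms make up the system to be solved. -/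
theorem coeff_mul_boxPolynomial_sq {R S : Type*} [CommRing R] [CommRing S] [Algebra R S] {m T : ℕ}
    (a : MvPolynomial (Fin m) R) (x : (Fin m → Fin T) → S) (μ : Fin m →₀ ℕ) :
    coeff μ (MvPolynomial.map (algebraMap R S) a * boxPolynomial x ^ 2) =
      ∑ ν, ∑ ν', algebraMap R S (coeff μ (a * monomial
        (Finsupp.equivFunOnFinite.symm (fun s => (ν s : ℕ)) +
          Finsupp.equivFunOnFinite.symm (fun s => (ν' s : ℕ))) 1)) * (x ν * x ν') := by
  rw [boxPolynomial, pow_two, Finset.sum_mul_sum, Finset.mul_sum, coeff_sum]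
  refine Finset.sum_congr rfl fun ν _ => ?_
  rw [Finset.mul_sum, coeff_sum]
  refine Finset.sum_congr rfl fun ν' _ => ?_
  rw [monomial_mul, coeff_mul_monomial', coeff_mul_monomial', coeff_map]
  split_ifs <;> simp

theorem coeff_mul_monomial_eq_zero_of_lt {R : Type*} [CommRing R] {m T c : ℕ}
    {a : MvPolynomial (Fin m) R} (s : Fin m) (ha : degreeOf s a ≤ c) (ν ν' : Fin m → Fin T)
    (μ : Fin m →₀ ℕ) (hμ : 2 * T + c ≤ μ s) :
    coeff μ (a * monomial (Finsupp.equivFunOnFinite.symm (fun s => (ν s : ℕ)) +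
          Finsupp.equivFunOnFinite.symm (fun s => (ν' s : ℕ))) 1) = 0 := by
  rw [coeff_mul_monomial']
  split_ifs with h
  · rw [mul_one]
    by_contra hne
    have hle := monomial_le_degreeOf s (mem_support_iff.mpr hne)
    have h1 := (ν s).isLt
    have h2 := (ν' s).isLt
    simp only [Finsupp.coe_tsub, Finsupp.coe_add, Pi.sub_apply, Pi.add_apply,
      Finsupp.equivFunOnFinite_symm_apply_apply] at hle
    omega
  · rfl

attribute [local instance] MvPolynomial.algebraMvPolynomial FractionRing.liftAlgebra

/-- The Tsen–Lang counting argument together with Springer's theorem. -/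
theorem PropertyA.polynomialDiagonalIsotropic {i : ℕ} {ℓ : Type u} [Field ℓ] (h : PropertyA i ℓ) :
    PolynomialDiagonalIsotropic ℓ i := by
  classical
  intro m ι _ hn a
  let c : ℕ := Finset.univ.sup fun p : ι × Fin m => degreeOf p.2 (a p.1)
  have hc : ∀ k s, degreeOf s (a k) ≤ c := fun k s =>
    Finset.le_sup (f := fun p : ι × Fin m => degreeOf p.2 (a p.1)) (Finset.mem_univ (k, s))
  -- There are |ι|·T^m unknown coefficients and (2T+c)^m equations, one for each monomial that can
  -- occur; T makes the unknowns exceed 2^i times the equations.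
  obtain ⟨T, hT⟩ := exists_pow_mul_lt_mul_pow m c (by rwa [pow_add] at hn)
  obtain ⟨E, _, _, hodd, x, hx, h0⟩ := h.exists_common_zero
    (κ := Fin m → Fin (2 * T + c)) (ι := ι × (Fin m → Fin T)) (by simpa using hT)
    fun μ p q => if p.1 = q.1 then coeff (Finsupp.equivFunOnFinite.symm fun s => (μ s : ℕ))
      (a p.1 * monomial (Finsupp.equivFunOnFinite.symm (fun s => (p.2 s : ℕ)) +
          Finsupp.equivFunOnFinite.symm (fun s => (q.2 s : ℕ))) 1) else 0
  let P : ι → MvPolynomial (Fin m) E := fun k => boxPolynomial fun ν => x (k, ν)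
  have hP : P ≠ 0 := fun hP => hx (by
    ext ⟨k, ν⟩
    exact congrFun (boxPolynomial_injective _ (congrFun hP k)) ν)
  have hP0 : ∑ k, MvPolynomial.map (algebraMap ℓ E) (a k) * P k ^ 2 = 0 := by
    ext μ
    rw [coeff_sum, coeff_zero]
    simp only [P, coeff_mul_boxPolynomial_sq]
    by_cases hμ : ∀ s, μ s < 2 * T + c
    · have := h0 fun s => ⟨μ s, hμ s⟩
      simp only [Fintype.sum_prod_type] at this
      rw [← this]
      refine Finset.sum_congr rfl fun k _ => Finset.sum_congr rfl fun ν _ => ?_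
      rw [Finset.sum_eq_single k]
      · refine Finset.sum_congr rfl fun ν' _ => ?_
        rw [if_pos rfl]
        congr
        ext s
        rfl
      · intro k' _ hk'
        simp [Ne.symm hk']
      · simp
    · push Not at hμ
      obtain ⟨s, hs⟩ := hμ
      refine Finset.sum_eq_zero fun k _ => Finset.sum_eq_zero fun ν _ =>
        Finset.sum_eq_zero fun ν' _ => ?_
      rw [coeff_mul_monomial_eq_zero_of_lt s (hc k s) ν ν' μ hs, map_zero, zero_mul]
  have : FiniteDimensional ℓ E := Module.finite_of_finrank_pos hodd.pos
  let K := FractionRing (MvPolynomial (Fin m) ℓ)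
  let F := FractionRing (MvPolynomial (Fin m) E)
  -- The extension E(X)/ℓ(X) inherits the odd degree of E/ℓ, so Springer's theorem applies over the
  -- rational function fields.
  have hKF : Module.finrank K F = Module.finrank ℓ E := by
    have := Algebra.IsAlgebraic.rank_fractionRing_mvPolynomial (R := ℓ) (S := E) (Fin m)
    rw [Module.finrank, this, Cardinal.toNat_lift]
    rfl
  refine exists_zero_of_fractionRing_zero (K := K) a ?_
  by_contra hcon
  push Not at hcon
  refine hP ?_
  have hzero := anisotropic_of_odd_finrank (K := K) (F := F) (hKF ▸ hodd)
    (a := fun k => algebraMap _ K (a k))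
    (fun y hy => by_contra fun hy0 => hcon y hy0 hy)
    (fun k => algebraMap _ F (P k)) (by
      rw [← map_zero (algebraMap (MvPolynomial (Fin m) E) F), ← hP0, map_sum]
      refine Finset.sum_congr rfl fun k _ => ?_
      rw [map_mul, map_pow, ← IsScalarTower.algebraMap_apply,
        IsScalarTower.algebraMap_apply _ (MvPolynomial (Fin m) E) F]
      rfl)
  ext1 k
  exact IsFractionRing.injective (MvPolynomial (Fin m) E) F
    ((congrFun hzero k).trans (map_zero _).symm)

end

/-! ### Descent to finite subextensions and the bound on u(L) -/

theorem PolynomialDiagonalIsotropic.of_adjoin_finset {k F : Type*} [Field k] [Field F] [Algebra k F]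
    [Algebra.IsAlgebraic k F] {j : ℕ} (h : PolynomialDiagonalIsotropic k j) (S : Finset F) :
    PolynomialDiagonalIsotropic (IntermediateField.adjoin k (S : Set F)) j := by
  refine IntermediateField.induction_on_adjoin_finset S
    (fun K => PolynomialDiagonalIsotropic K j) ?_ fun K x _ hK => ?_
  · exact h.of_ringEquiv (IntermediateField.botEquiv k F).symm.toRingEquiv
  · have hint : IsIntegral K x := (Algebra.IsIntegral.isIntegral (R := k) x).tower_top
    have hgen : IsIntegral K (IntermediateField.AdjoinSimple.gen K x) :=
      (IntermediateField.AdjoinSimple.isIntegral_gen K x).mpr hint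
    refine PolynomialDiagonalIsotropic.of_algebraic (F := IntermediateField.adjoin K {x}) hK
      (IntermediateField.AdjoinSimple.gen K x) hgen fun y => ?_
    obtain ⟨p, hp⟩ := (IntermediateField.adjoin.powerBasis hint).exists_eq_aeval' y
    exact ⟨p, by rw [hp, IntermediateField.adjoin.powerBasis_gen]⟩

/-- The finitely many coefficients of a form lie in a finitely generated subextension, reached by
successive simple extensions. -/
theorem PolynomialDiagonalIsotropic.diagonalIsotropicAbove_of_isAlgebraic {k F : Type*} [Field k]
    [Field F] [Algebra k F] [Algebra.IsAlgebraic k F] {j : ℕ}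
    (h : PolynomialDiagonalIsotropic k j) : DiagonalIsotropicAbove F (2 ^ j) := by
  classical
  intro ι _ hn a
  let S := Finset.univ.image a
  have hS : ∀ t, a t ∈ IntermediateField.adjoin k (S : Set F) := fun t =>
    IntermediateField.subset_adjoin _ _ (by simp [S])
  obtain ⟨x, hx, h0⟩ := (h.of_adjoin_finset S).self ι hn fun t => ⟨a t, hS t⟩
  refine ⟨fun t => x t, fun hx0 => hx ?_, ?_⟩
  · ext t
    exact congrFun hx0 t
  · simpa using congrArg Subtype.val h0

/-- If `ℓ` has property `𝒜_i(2)` then the `u`-invariant of an extension of transcendence degree `r`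
is at most `2 ^ (i + r)`. -/
theorem PropertyA.diagonalIsotropicAbove {i r : ℕ} {ℓ : Type u} {L : Type w} [Field ℓ] [Field L]
    [Algebra ℓ L] (h : PropertyA i ℓ) (htr : Algebra.trdeg ℓ L = r) :
    DiagonalIsotropicAbove L (2 ^ (i + r)) := by
  obtain ⟨s, hs⟩ := exists_isTranscendenceBasis ℓ L
  have hcard : Cardinal.mk s = r := hs.cardinalMk_eq_trdeg.trans htr
  obtain ⟨e⟩ := Cardinal.mk_eq_nat_iff.mp hcard
  let x : Fin r → L := fun k => (e.symm k : L)
  have hx : IsTranscendenceBasis ℓ x := hs.comp_equiv e.symm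
  have := hx.isAlgebraic_field
  have hF : PolynomialDiagonalIsotropic (FractionRing (MvPolynomial (Fin r) ℓ)) (i + r) :=
    h.polynomialDiagonalIsotropic.of_isFractionRing
  exact (hF.of_ringEquiv hx.1.aevalEquivField.toRingEquiv).diagonalIsotropicAbove_of_isAlgebraic

/-! ### Square roots in complete discretely valued fields -/

section Valued

open Filter Topology

/-- The basic neighbourhoods of 0 are indexed by units of the value group of `Valued.v`; `ℤᵐ⁰` being
archimedean, powers of v(t) < 1 fall below each of them. -/
theorem Valued.eventually_restrict_lt_of_le_pow {E : Type*} [Field E] [Valued E ℤᵐ⁰] {t : E}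
    (ht : Valued.v t < 1)
    (γ : (MonoidWithZeroHom.ValueGroup₀ (.ofClass (Valued.v : Valuation E ℤᵐ⁰)))ˣ) :
    ∃ N : ℕ, ∀ x : E, ∀ n ≥ N, Valued.v x ≤ Valued.v t ^ n →
      (Valued.v : Valuation E ℤᵐ⁰).restrict x < γ.1 := by
  obtain ⟨N, hN⟩ := exists_pow_lt₀ ht (Units.map (MonoidWithZeroHom.ValueGroup₀.embedding
    (f := (.ofClass (Valued.v : Valuation E ℤᵐ⁰)))) γ)
  refine ⟨N, fun x n hn hx => ?_⟩
  rw [Valuation.restrict_lt_iff_lt_embedding]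
  exact (hx.trans (pow_le_pow_right_of_le_one' ht.le hn)).trans_lt hN

/-- In a complete discretely valued field in which `2` is a unit, `1 + t` is a square for `t` in
the maximal ideal. -/
theorem Valued.exists_sq_eq_one_add {E : Type*} [Field E] [Valued E ℤᵐ⁰] [CompleteSpace E]
    [T2Space E] (h2 : Valued.v (2 : E) = 1) {t : E} (ht : Valued.v t < 1) :
    ∃ s : E, s ^ 2 = 1 + t := by
  have h20 : (2 : E) ≠ 0 := by
    intro h
    simp [h] at h2
  -- Newton iteration for Y² - (1 + t) started at 1, with the derivative frozen at 2. As y_n stays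
  -- congruent to 1, each step gains a factor v(t) in the error.
  let y : ℕ → E := fun n => Nat.rec 1 (fun _ z => z - (z ^ 2 - (1 + t)) / 2) n
  have hy : ∀ n, y (n + 1) = y n - (y n ^ 2 - (1 + t)) / 2 := fun n => rfl
  have key : ∀ n, Valued.v (y n - 1) ≤ Valued.v t ∧
      Valued.v (y n ^ 2 - (1 + t)) ≤ Valued.v t ^ (n + 1) := by
    intro n
    induction n with
    | zero =>
      constructor
      · simp [y]
      · have : y 0 ^ 2 - (1 + t) = -t := by simp [y]
        rw [this, Valuation.map_neg, zero_add, pow_one]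
    | succ n ih =>
      obtain ⟨ih₁, ih₂⟩ := ih
      set e := y n ^ 2 - (1 + t) with he
      have het : Valued.v e ≤ Valued.v t :=
        ih₂.trans ((pow_le_pow_right_of_le_one' ht.le (Nat.le_add_left 1 n)).trans_eq (pow_one _))
      have he2 : Valued.v (e / 2) = Valued.v e := by rw [map_div₀, h2, div_one]
      have he4 : Valued.v (e / 2 / 2) = Valued.v e := by rw [map_div₀, h2, div_one, he2]
      constructor
      · rw [hy, show y n - e / 2 - 1 = (y n - 1) - e / 2 by ring]
        exact Valuation.map_sub_le _ ih₁ (he2.trans_le het)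
      · have : y (n + 1) ^ 2 - (1 + t) = e * (e / 2 / 2 - (y n - 1)) := by
          rw [hy, he]; field_simp; ring
        rw [this, map_mul, pow_succ]
        exact mul_le_mul' ih₂ (Valuation.map_sub_le _ (he4.trans_le het) ih₁)
  have hdiff : ∀ n k, Valued.v (y (n + k) - y n) ≤ Valued.v t ^ n := by
    intro n k
    induction k with
    | zero => simp
    | succ k ih =>
      rw [show y (n + (k + 1)) - y n = (y (n + k) - y n) - (y (n + k) ^ 2 - (1 + t)) / 2 by
        rw [← add_assoc, hy]; ring]
      refine Valuation.map_sub_le _ ih ?_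
      rw [map_div₀, h2, div_one]
      exact (key (n + k)).2.trans (pow_le_pow_right_of_le_one' ht.le (by omega))
  have hcauchy : CauchySeq y := by
    rw [(Valued.hasBasis_uniformity E ℤᵐ⁰).cauchySeq_iff]
    intro γ _
    obtain ⟨N, hN⟩ := Valued.eventually_restrict_lt_of_le_pow ht γ
    refine ⟨N, fun m hm n hn => hN _ N le_rfl ?_⟩
    obtain ⟨a, rfl⟩ := Nat.exists_eq_add_of_le hm
    obtain ⟨b, rfl⟩ := Nat.exists_eq_add_of_le hn
    change Valued.v (y (N + b) - y (N + a)) ≤ _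
    rw [show y (N + b) - y (N + a) = (y (N + b) - y N) - (y (N + a) - y N) by ring]
    exact Valuation.map_sub_le _ (hdiff N b) (hdiff N a)
  obtain ⟨s, hs⟩ := cauchySeq_tendsto_of_complete hcauchy
  refine ⟨s, ?_⟩
  have h1 : Tendsto (fun n => y n ^ 2 - (1 + t)) atTop (𝓝 (s ^ 2 - (1 + t))) :=
    (hs.pow 2).sub_const _
  have h0 : Tendsto (fun n => y n ^ 2 - (1 + t)) atTop (𝓝 0) := by
    rw [(Valued.hasBasis_nhds_zero E ℤᵐ⁰).tendsto_right_iff]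
    intro γ _
    obtain ⟨N, hN⟩ := Valued.eventually_restrict_lt_of_le_pow ht γ
    filter_upwards [eventually_ge_atTop N] with n hn
    exact hN _ (n + 1) (by omega) (key n).2
  exact sub_eq_zero.mp (tendsto_nhds_unique h1 h0)

end Valued

/-! ### Isotropy over completions, seen from the field -/

section Completion

variable {K : Type w} [Field K]

theorem valued_algebraMap_completion (v : Valuation K ℤᵐ⁰) (x : K) :
    Valued.v (algebraMap K v.Completion x) = v x :=
  Valued.valuedCompletion_apply _

/-- The diagonal form with coefficients `a` takes a value that is `v`-adically smaller than one of
its terms. When `v 2 = 1`, this is equivalent to isotropy over the completion at `v`. -/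
def ApproxIsotropic (v : Valuation K ℤᵐ⁰) {ι : Type*} [Fintype ι] (a : ι → K) : Prop :=
  ∃ (x : ι → K) (j : ι), v (∑ k, a k * x k ^ 2) < v (a j * x j ^ 2)

theorem ApproxIsotropic.of_isEquiv {v v' : Valuation K ℤᵐ⁰} (h : v.IsEquiv v') {ι : Type*}
    [Fintype ι] {a : ι → K} (ha : ApproxIsotropic v a) : ApproxIsotropic v' a := by
  obtain ⟨x, j, hx⟩ := ha
  exact ⟨x, j, Valuation.isEquiv_iff_val_lt_val.mp h |>.mp hx⟩

theorem ApproxIsotropic.of_injective {v : Valuation K ℤᵐ⁰} {ι κ : Type*} [Fintype ι] [Fintype κ]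
    {a : ι → K} {b : κ → K} (f : ι → κ) (hf : Function.Injective f) (hab : ∀ k, b (f k) = a k)
    (ha : ApproxIsotropic v a) : ApproxIsotropic v b := by
  classical
  obtain ⟨x, j, hx⟩ := ha
  refine ⟨Function.extend f x 0, f j, ?_⟩
  rw [hab, hf.extend_apply]
  convert hx using 2
  rw [← Finset.sum_subset (Finset.subset_univ (Finset.univ.map ⟨f, hf⟩))]
  · rw [Finset.sum_map]
    refine Finset.sum_congr rfl fun k _ => ?_
    simp [hab, hf.extend_apply]
  · intro k _ hk
    rw [Function.extend_apply']
    · simp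
    · rintro ⟨j, rfl⟩
      simp at hk

/-- With δ the value at x, the quotient δ/(a_j x_j²) lies in the maximal ideal. Multiplying x_j by a
square root of 1 - δ/(a_j x_j²) lowers the value by exactly δ. -/
theorem ApproxIsotropic.exists_zero_completion {v : Valuation K ℤᵐ⁰} (h2 : v 2 = 1) {ι : Type*}
    [Fintype ι] {a : ι → K} (ha : ApproxIsotropic v a) :
    ∃ y : ι → v.Completion, y ≠ 0 ∧ ∑ k, algebraMap K v.Completion (a k) * y k ^ 2 = 0 := by
  classical
  obtain ⟨x, j, hx⟩ := ha
  set δ := ∑ k, a k * x k ^ 2 with hδ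
  have hne : a j * x j ^ 2 ≠ 0 := fun h => by simp [h] at hx
  have h2' : Valued.v (2 : v.Completion) = 1 := by
    rw [← map_ofNat (algebraMap K v.Completion) 2, valued_algebraMap_completion, h2]
  obtain ⟨s, hs⟩ := Valued.exists_sq_eq_one_add h2'
    (t := algebraMap K v.Completion (-(δ / (a j * x j ^ 2)))) (by
      rw [valued_algebraMap_completion, Valuation.map_neg, map_div₀]
      exact (div_lt_one₀ (zero_lt_iff.mpr ((Valuation.ne_zero_iff _).mpr hne))).mpr hx)
  have hval : algebraMap K v.Completion (a j * x j ^ 2) * s ^ 2 =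
      algebraMap K v.Completion (a j * x j ^ 2 - δ) := by
    rw [hs, ← map_one (algebraMap K v.Completion), ← map_add, ← map_mul]
    congr 1
    rw [mul_add, mul_one, mul_neg, mul_div_cancel₀ _ hne, sub_eq_add_neg]
  have hs0 : algebraMap K v.Completion (x j) * s ≠ 0 := by
    refine mul_ne_zero ((map_ne_zero _).mpr fun h => hne (by simp [h])) fun h => ?_
    rw [h, zero_pow two_ne_zero, mul_zero, eq_comm, map_eq_zero, sub_eq_zero] at hval
    rw [hval] at hx
    exact lt_irrefl _ hx
  refine ⟨Function.update (fun k => algebraMap K v.Completion (x k)) j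
    (algebraMap K v.Completion (x j) * s), fun h => hs0 (by simpa using congrFun h j), ?_⟩
  rw [← Finset.add_sum_erase _ _ (Finset.mem_univ j), Function.update_self]
  have hsum : ∑ k ∈ Finset.univ.erase j, algebraMap K v.Completion (a k) *
      Function.update (fun k => algebraMap K v.Completion (x k)) j
        (algebraMap K v.Completion (x j) * s) k ^ 2 =
      algebraMap K v.Completion (δ - a j * x j ^ 2) := by
    rw [hδ, ← Finset.add_sum_erase _ _ (Finset.mem_univ j), add_sub_cancel_left, map_sum]
    refine Finset.sum_congr rfl fun k hk => ?_
    rw [Function.update_of_ne (Finset.ne_of_mem_erase hk), map_mul, map_pow]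
  rw [hsum, mul_pow, ← mul_assoc, ← map_pow, ← map_mul, hval, ← map_add]
  simp

/-- Approximation of a zero over the completion by a vector over the field. -/
theorem exists_lt_of_zero_completion {v : Valuation K ℤᵐ⁰} {ι : Type*} [Fintype ι] {a : ι → K}
    {y : ι → v.Completion} (hy : ∑ k, algebraMap K v.Completion (a k) * y k ^ 2 = 0) {j : ι}
    (haj : a j ≠ 0) (hj : y j ≠ 0) :
    ∃ x : ι → K, v (∑ k, a k * x k ^ 2) < v (a j * x j ^ 2) := by
  let A := algebraMap K v.Completion
  -- This ratio is continuous near y and vanishes at y, so by density of K it has value less than 1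
  -- at some vector over K.
  let f : (ι → v.Completion) → v.Completion := fun z => (∑ k, A (a k) * z k ^ 2) / (A (a j) * z j ^ 2)
  have hAj : A (a j) * y j ^ 2 ≠ 0 := mul_ne_zero ((map_ne_zero _).mpr haj) (pow_ne_zero _ hj)
  have hf : ContinuousAt f y := by
    refine ContinuousAt.div (Continuous.continuousAt ?_) (Continuous.continuousAt ?_) hAj
    · exact continuous_finsetSum _ fun k _ => ((continuous_apply k).pow 2).const_mul _
    · exact ((continuous_apply j).pow 2).const_mul _
  have hfy : f y = 0 := by simp only [f, A, hy, zero_div]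
  have hU : {t : v.Completion | Valued.v t < 1} ∈ nhds (f y) := by
    rw [hfy, Valued.mem_nhds_zero]
    exact ⟨1, fun t ht => by simpa [Valuation.restrict_lt_iff_lt_embedding] using ht⟩
  have hV : {z : ι → v.Completion | z j ≠ 0} ∈ nhds y :=
    (continuous_apply j).continuousAt.preimage_mem_nhds (isOpen_ne.mem_nhds hj)
  have hdense : DenseRange (Pi.map fun (_ : ι) (x : WithVal v) => (x : v.Completion)) :=
    DenseRange.piMap fun _ => UniformSpace.Completion.denseRange_coe
  obtain ⟨x, hxU, hxV⟩ := hdense.mem_nhds (Filter.inter_mem (hf hU) hV)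
  refine ⟨fun k => (x k).ofVal, ?_⟩
  have hxj : (x j).ofVal ≠ 0 := fun h => hxV (by
    have : x j = 0 := by simpa using h
    simp [this])
  have hval : f (Pi.map (fun (_ : ι) (x : WithVal v) => (x : v.Completion)) x) =
      A ((∑ k, a k * (x k).ofVal ^ 2) / (a j * (x j).ofVal ^ 2)) := by
    simp only [f, map_div₀, map_sum, map_mul, map_pow]
    rfl
  have hlt : Valued.v (f (Pi.map (fun (_ : ι) (x : WithVal v) => (x : v.Completion)) x)) < 1 := hxU
  rw [hval, valued_algebraMap_completion, map_div₀] at hlt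
  exact (div_lt_one₀ (zero_lt_iff.mpr ((Valuation.ne_zero_iff _).mpr
    (mul_ne_zero haj (pow_ne_zero 2 hxj))))).mp hlt

/-- Continuity of z ↦ bz² at y: with d = z - y and c = 2y the increment is b·d·(c + d). -/
theorem Valuation.exists_forall_lt_mul_mul_add_lt (v : Valuation K ℤᵐ⁰) {ε : ℤᵐ⁰} (hε : ε ≠ 0)
    (b c : K) : ∃ γ : ℤᵐ⁰, γ ≠ 0 ∧ ∀ d, v d < γ → v (b * (d * (c + d))) < ε := by
  set M : ℤᵐ⁰ := max 1 (v b * max (v c) 1) with hM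
  have hM0 : 0 < M := lt_of_lt_of_le zero_lt_one (le_max_left _ _)
  refine ⟨min 1 (ε / M), ?_, fun d hd => ?_⟩
  · exact (lt_min zero_lt_one (div_pos (zero_lt_iff.mpr hε) hM0)).ne'
  · have h1 : v (c + d) ≤ max (v c) 1 :=
      (v.map_add c d).trans (max_le_max le_rfl (hd.le.trans (min_le_left _ _)))
    calc v (b * (d * (c + d))) = v d * (v b * v (c + d)) := by
          rw [map_mul, map_mul, mul_left_comm]
      _ ≤ v d * M := mul_le_mul_right ((mul_le_mul_right h1 _).trans (le_max_right _ _)) _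
      _ < ε := (lt_div_iff₀ hM0).mp (hd.trans_le (min_le_right _ _))

theorem Valuation.exists_forall_sub_lt_sum_mul_sq_sub_lt (v : Valuation K ℤᵐ⁰) {ε : ℤᵐ⁰}
    (hε : ε ≠ 0) {κ : Type*} [Fintype κ] (b y : κ → K) :
    ∃ γ : κ → ℤᵐ⁰, (∀ k, γ k ≠ 0) ∧ ∀ z : κ → K, (∀ k, v (z k - y k) < γ k) →
      v (∑ k, b k * z k ^ 2 - ∑ k, b k * y k ^ 2) < ε := by
  choose γ hγ0 hγ using fun k => v.exists_forall_lt_mul_mul_add_lt hε (b k) (2 * y k)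
  refine ⟨γ, hγ0, fun z hz => ?_⟩
  rw [← Finset.sum_sub_distrib]
  refine Valuation.map_sum_lt _ hε fun k _ => ?_
  convert hγ k _ (hz k) using 2
  ring

/-- If `⟨a⟩ ⊥ ⟨b⟩` is isotropic over the completion at `v`, then there is a `v`-adically open
condition on vectors `z` which ensures that `⟨a⟩ ⊥ ⟨b(z)⟩` is isotropic over the completion. -/
theorem exists_forall_sub_lt_approxIsotropic {v : Valuation K ℤᵐ⁰} (h2 : (2 : K) ≠ 0) {ι κ : Type*}
    [Fintype ι] [Nonempty ι] [Fintype κ] {a : ι → K} {b : κ → K} (ha : ∀ k, a k ≠ 0)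
    (hb : ∀ k, b k ≠ 0)
    (h : ∃ y : ι ⊕ κ → v.Completion, y ≠ 0 ∧
      ∑ k, algebraMap K v.Completion (Sum.elim a b k) * y k ^ 2 = 0) :
    ∃ (y : κ → K) (γ : κ → ℤᵐ⁰), (∀ k, γ k ≠ 0) ∧ ∀ z : κ → K, (∀ k, v (z k - y k) < γ k) →
      ApproxIsotropic v (Sum.elim a fun _ : Unit => ∑ k, b k * z k ^ 2) := by
  classical
  -- A zero with a nonzero coordinate in the first summand is needed, so that the dominating term
  -- does not involve z. If y lives only in the second summand, that summand is isotropic, hence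
  -- represents -a_j.
  have key : ∃ (y : ι ⊕ κ → v.Completion) (j : ι), y (Sum.inl j) ≠ 0 ∧
      ∑ k, algebraMap K v.Completion (Sum.elim a b k) * y k ^ 2 = 0 := by
    obtain ⟨y, hy, h0⟩ := h
    by_cases hinl : ∃ j, y (Sum.inl j) ≠ 0
    · exact ⟨y, hinl.choose, hinl.choose_spec, h0⟩
    push Not at hinl
    obtain ⟨k, hk⟩ := Function.ne_iff.mp hy
    rcases k with k | k
    · exact absurd (hinl k) hk
    obtain ⟨j⟩ := ‹Nonempty ι›
    simp only [Fintype.sum_sum_type, Sum.elim_inl, Sum.elim_inr, hinl] at h0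
    simp only [ne_eq, OfNat.ofNat_ne_zero, not_false_eq_true, zero_pow, mul_zero,
      Finset.sum_const_zero, zero_add] at h0
    let A := algebraMap K v.Completion
    have hA2 : (2 : v.Completion) ≠ 0 := by
      rw [← map_ofNat A 2]; exact (map_ne_zero _).mpr h2
    have hbk : A (b k) ≠ 0 := (map_ne_zero _).mpr (hb k)
    have hyk : y (Sum.inr k) ≠ 0 := hk
    -- As b(y) = 0, b(sy + e_k) = 2s b_k y_k + b_k; this s makes it equal to -a_j.
    let s : v.Completion := (-A (a j) - A (b k)) / (2 * A (b k) * y (Sum.inr k))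
    refine ⟨Sum.elim (Pi.single j 1) fun l => s * y (Sum.inr l) + Pi.single (M := fun _ => _) k 1 l,
      j, by simp, ?_⟩
    have hsum : ∑ l, A (b l) * (s * y (Sum.inr l) + Pi.single (M := fun _ => _) k 1 l) ^ 2 =
        s ^ 2 * (∑ l, A (b l) * y (Sum.inr l) ^ 2) + (2 * s * A (b k) * y (Sum.inr k) + A (b k)) := by
      have h1 : ∑ l, A (b l) * (2 * s * y (Sum.inr l) + 1) * Pi.single (M := fun _ => _) k 1 l =
          2 * s * A (b k) * y (Sum.inr k) + A (b k) := by
        rw [Finset.sum_eq_single k]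
        · simp; ring
        · intro l _ hl
          simp [Pi.single_eq_of_ne hl]
        · simp
      rw [← h1, Finset.mul_sum, ← Finset.sum_add_distrib]
      refine Finset.sum_congr rfl fun l _ => ?_
      by_cases hl : l = k
      · subst hl
        simp; ring
      · simp [Pi.single_eq_of_ne hl]; ring
    simp only [Fintype.sum_sum_type, Sum.elim_inl, Sum.elim_inr]
    rw [Finset.sum_eq_single j]
    · rw [hsum, h0]
      simp only [s, Pi.single_eq_same]
      change A (a j) * 1 ^ 2 + _ = _
      field_simp
      ring
    · intro l _ hl
      simp [Pi.single_eq_of_ne hl]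
    · simp
  obtain ⟨y, j, hj, h0⟩ := key
  obtain ⟨x, hx⟩ := exists_lt_of_zero_completion (j := Sum.inl j) h0 (ha j) hj
  simp only [Fintype.sum_sum_type, Sum.elim_inl, Sum.elim_inr] at hx
  obtain ⟨γ, hγ0, hγ⟩ := v.exists_forall_sub_lt_sum_mul_sq_sub_lt (ne_zero_of_lt hx) b
    fun k => x (Sum.inr k)
  refine ⟨fun k => x (Sum.inr k), γ, hγ0, fun z hz => ⟨Sum.elim (fun k => x (Sum.inl k)) fun _ => 1, Sum.inl j, ?_⟩⟩
  simp only [Fintype.sum_sum_type, Sum.elim_inl, Sum.elim_inr, Finset.univ_unique,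
    Finset.sum_singleton, one_pow, mul_one]
  convert v.map_add_lt hx (hγ z hz) using 2
  ring

/-- A nontrivial discrete valuation takes a value that is not a square of a value. -/
theorem Valuation.exists_forall_sq_ne (v : Valuation K ℤᵐ⁰) (hv : v.IsNontrivial) :
    ∃ π : K, π ≠ 0 ∧ ∀ z : K, z ≠ 0 → v z ^ 2 ≠ v π := by
  by_contra hcon
  push Not at hcon
  obtain ⟨a, ha0, ha1⟩ := hv.exists_val_nontrivial
  have ha : a ≠ 0 := (Valuation.ne_zero_iff _).mp ha0
  -- If every value were a square, every logarithm would be divisible by all powers of 2, hence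
  -- zero.
  have hdiv : ∀ (n : ℕ) (x : K), x ≠ 0 → (2 : ℤ) ^ n ∣ WithZero.log (v x) := by
    intro n
    induction n with
    | zero => simp
    | succ n ih =>
      intro x hx
      obtain ⟨z, hz, hzx⟩ := hcon x hx
      rw [← hzx, WithZero.log_pow, pow_succ', nsmul_eq_mul]
      exact mul_dvd_mul (by simp) (ih z hz)
  have hlog : WithZero.log (v a) ≠ 0 := by
    intro h
    apply ha1
    rw [← WithZero.exp_log ha0, h, WithZero.exp_zero]
  have hle := Int.le_of_dvd (by positivity) ((dvd_abs _ _).mpr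
    (hdiv (WithZero.log (v a)).natAbs a ha))
  have hlt := Nat.lt_two_pow_self (n := (WithZero.log (v a)).natAbs)
  rw [Int.abs_eq_natAbs] at hle
  exact absurd (by exact_mod_cast hle) (not_le.mpr hlt)

/-- Take x_j of maximal value: the ultrametric inequality bounds the sum above, and failure of
approximate isotropy at (x, j) bounds it below. -/
theorem exists_map_sum_mul_sq_eq_sq {v : Valuation K ℤᵐ⁰} {ι : Type*} [Fintype ι] {a : ι → K}
    (ha : ∀ k, v (a k) = 1) (h : ¬ ApproxIsotropic v a) {x : ι → K} (hx : x ≠ 0) :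
    ∃ j, x j ≠ 0 ∧ v (∑ k, a k * x k ^ 2) = v (x j) ^ 2 := by
  obtain ⟨k, hk⟩ := Function.ne_iff.mp hx
  obtain ⟨j, -, hj⟩ := Finset.exists_max_image Finset.univ (fun k => v (x k)) ⟨k, by simp⟩
  have hjval : v (a j * x j ^ 2) = v (x j) ^ 2 := by rw [map_mul, map_pow, ha, one_mul]
  refine ⟨j, fun h0 => hk ?_, le_antisymm ?_ ?_⟩
  · have := hj k (by simp)
    simpa [h0] using this
  · refine Valuation.map_sum_le _ fun k _ => ?_
    rw [map_mul, map_pow, ha, one_mul]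
    exact pow_le_pow_left₀ zero_le (hj k (by simp)) 2
  · rw [← hjval]
    by_contra hlt
    exact h ⟨x, j, not_le.mp hlt⟩

/-- A diagonal form with unit coefficients in more than half as many variables as the
`u`-invariant is isotropic at every nontrivial discrete valuation. -/
theorem approxIsotropic_of_units {v : Valuation K ℤᵐ⁰} (hv : v.IsNontrivial) {n : ℕ}
    (hK : DiagonalIsotropicAbove K (2 * n)) {ι : Type} [Fintype ι] (hn : n < Fintype.card ι)
    {a : ι → K} (ha : ∀ k, v (a k) = 1) : ApproxIsotropic v a := by
  by_contra hcon
  obtain ⟨π, hπ0, hπ⟩ := v.exists_forall_sq_ne hv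
  -- A zero of a ⊥ πa equates the values of two halves. Were a not approximately isotropic, each
  -- nonzero half would have a square value, making v(π) a square or leaving a single nonzero half.
  obtain ⟨x, hx, h0⟩ := hK (ι ⊕ ι) (by simp; omega) (Sum.elim a fun k => π * a k)
  simp only [Fintype.sum_sum_type, Sum.elim_inl, Sum.elim_inr, mul_assoc, ← Finset.mul_sum] at h0
  have hval : v (∑ k, a k * x (Sum.inl k) ^ 2) = v π * v (∑ k, a k * x (Sum.inr k) ^ 2) := by
    rw [eq_neg_of_add_eq_zero_left h0, Valuation.map_neg, map_mul]
  by_cases hl : (fun k => x (Sum.inl k)) = 0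
  · by_cases hr : (fun k => x (Sum.inr k)) = 0
    · refine hx (funext fun k => ?_)
      rcases k with k | k
      · exact congrFun hl k
      · exact congrFun hr k
    · obtain ⟨j, hj0, hj⟩ := exists_map_sum_mul_sq_eq_sq ha hcon hr
      have hl' : ∀ k, x (Sum.inl k) = 0 := congrFun hl
      rw [hj] at hval
      simp [hl', hπ0, hj0] at hval
  · obtain ⟨i, hi0, hi⟩ := exists_map_sum_mul_sq_eq_sq ha hcon hl
    by_cases hr : (fun k => x (Sum.inr k)) = 0
    · have hr' : ∀ k, x (Sum.inr k) = 0 := congrFun hr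
      rw [hi] at hval
      simp [hr', hi0] at hval
    · obtain ⟨j, hj0, hj⟩ := exists_map_sum_mul_sq_eq_sq ha hcon hr
      rw [hi, hj] at hval
      refine hπ (x (Sum.inl i) / x (Sum.inr j)) (div_ne_zero hi0 hj0) ?_
      rw [map_div₀, div_pow, hval, mul_div_assoc, div_self, mul_one]
      exact pow_ne_zero 2 ((Valuation.ne_zero_iff _).mpr hj0)

end Completion

/-! ### Weak approximation -/

section WeakApproximation

variable {K : Type w} [Field K]

/-- The real absolute value attached to a discrete valuation. -/
noncomputable def Valuation.intAbsoluteValue (v : Valuation K ℤᵐ⁰) : AbsoluteValue K ℝ where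
  toFun x := (WithZeroMulInt.toNNReal (e := 2) two_ne_zero (v x) : ℝ)
  map_mul' x y := by simp
  nonneg' x := NNReal.coe_nonneg _
  eq_zero' x := by simp
  add_le' x y := by
    have hmono := (WithZeroMulInt.toNNReal_strictMono (e := 2) one_lt_two).monotone
    have h := hmono (v.map_add x y)
    rw [hmono.map_max] at h
    exact_mod_cast h.trans (max_le_add_of_nonneg zero_le zero_le)

theorem Valuation.intAbsoluteValue_apply (v : Valuation K ℤᵐ⁰) (x : K) :
    v.intAbsoluteValue x = (WithZeroMulInt.toNNReal (e := 2) two_ne_zero (v x) : ℝ) := rfl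

theorem Valuation.intAbsoluteValue_lt_iff (v : Valuation K ℤᵐ⁰) (x : K) (γ : ℤᵐ⁰) :
    v.intAbsoluteValue x < (WithZeroMulInt.toNNReal (e := 2) two_ne_zero γ : ℝ) ↔ v x < γ := by
  rw [v.intAbsoluteValue_apply, NNReal.coe_lt_coe,
    (WithZeroMulInt.toNNReal_strictMono (e := 2) one_lt_two).lt_iff_lt]

theorem Valuation.intAbsoluteValue_le_iff (v : Valuation K ℤᵐ⁰) (x y : K) :
    v.intAbsoluteValue x ≤ v.intAbsoluteValue y ↔ v x ≤ v y := by
  rw [v.intAbsoluteValue_apply, v.intAbsoluteValue_apply, NNReal.coe_le_coe,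
    (WithZeroMulInt.toNNReal_strictMono (e := 2) one_lt_two).le_iff_le]

theorem Valuation.intAbsoluteValue_isNontrivial {v : Valuation K ℤᵐ⁰} (hv : v.IsNontrivial) :
    v.intAbsoluteValue.IsNontrivial := by
  obtain ⟨a, ha0, ha1⟩ := hv.exists_val_nontrivial
  refine ⟨a, (Valuation.ne_zero_iff _).mp ha0, fun h => ha1 ?_⟩
  refine (WithZeroMulInt.toNNReal_strictMono (e := 2) one_lt_two).injective ?_
  rw [map_one]
  exact NNReal.coe_injective (h.trans NNReal.coe_one.symm)

/-- **Weak approximation** for discrete valuations. -/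
theorem Valuation.exists_forall_sub_lt {τ : Type*} [Finite τ] {v : τ → Valuation K ℤᵐ⁰}
    (hv : ∀ t, (v t).IsNontrivial) (hne : Pairwise fun s t => ¬ (v s).IsEquiv (v t))
    (y : τ → K) {γ : τ → ℤᵐ⁰} (hγ : ∀ t, γ t ≠ 0) : ∃ z : K, ∀ t, v t (z - y t) < γ t := by
  have hdense := AbsoluteValue.denseRange_algebraMap_pi (v := fun t => (v t).intAbsoluteValue)
    (fun t => Valuation.intAbsoluteValue_isNontrivial (hv t))
    fun s t hst h => hne hst fun a b => by
      rw [← Valuation.intAbsoluteValue_le_iff, ← Valuation.intAbsoluteValue_le_iff]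
      exact h a b
  obtain ⟨z, hz⟩ := hdense.mem_nhds (x := fun t => (WithAbs.equiv (v t).intAbsoluteValue).symm (y t))
    (set_pi_mem_nhds (Set.toFinite Set.univ) fun t _ => Metric.ball_mem_nhds _
      (NNReal.coe_pos.mpr (WithZeroMulInt.toNNReal_pos (e := 2) two_ne_zero (hγ t))))
  refine ⟨z, fun t => ?_⟩
  have := hz t (Set.mem_univ t)
  rw [Metric.mem_ball, dist_eq_norm] at this
  rw [← Valuation.intAbsoluteValue_lt_iff]
  exact this

end WeakApproximation

/-! ### Intermediate subspaces and diagonalization -/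

section LinearAlgebra

variable {K : Type*} [Field K]

theorem Submodule.exists_le_finrank_eq {M : Type*} [AddCommGroup M] [Module K M]
    [FiniteDimensional K M] (U : Submodule K M) {m : ℕ} (h₁ : Module.finrank K U ≤ m)
    (h₂ : m ≤ Module.finrank K M) : ∃ W : Submodule K M, U ≤ W ∧ Module.finrank K W = m := by
  induction m, h₁ using Nat.le_induction with
  | base => exact ⟨U, le_rfl, rfl⟩
  | succ m _ ih =>
    obtain ⟨W, hUW, hW⟩ := ih (by omega)
    obtain ⟨x, hx⟩ : ∃ x, x ∉ W := by
      by_contra! hcon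
      rw [(Submodule.eq_top_iff').mpr hcon, finrank_top] at hW
      omega
    refine ⟨W ⊔ K ∙ x, hUW.trans le_sup_left, ?_⟩
    rw [Submodule.finrank_sup_span_singleton hx, hW]

/-- An injective linear map factors through injective linear maps of every intermediate
dimension. -/
theorem LinearMap.exists_injective_comp_eq {n m p : ℕ} (f : (Fin n → K) →ₗ[K] (Fin p → K))
    (hf : Function.Injective f) (hnm : n ≤ m) (hmp : m ≤ p) :
    ∃ (h : (Fin n → K) →ₗ[K] (Fin m → K)) (g : (Fin m → K) →ₗ[K] (Fin p → K)),
      Function.Injective h ∧ Function.Injective g ∧ g ∘ₗ h = f := by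
  obtain ⟨W, hfW, hW⟩ := Submodule.exists_le_finrank_eq (LinearMap.range f) (m := m)
    (by rw [LinearMap.finrank_range_of_inj hf]; simpa) (by simpa)
  let e : W ≃ₗ[K] (Fin m → K) := LinearEquiv.ofFinrankEq _ _ (by simpa)
  let f' : (Fin n → K) →ₗ[K] W := f.codRestrict W fun x => hfW ⟨x, rfl⟩
  refine ⟨e.toLinearMap ∘ₗ f', W.subtype ∘ₗ e.symm.toLinearMap, ?_, ?_, ?_⟩
  · exact e.injective.comp fun x y hxy => hf (congrArg Subtype.val hxy)
  · exact W.injective_subtype.comp e.symm.injective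
  · ext x
    simp [f']

theorem QuadraticMap.Anisotropic.nondegenerate {M : Type*} [AddCommGroup M] [Module K M]
    (h2 : (2 : K) ≠ 0) {q : QuadraticForm K M} (hq : q.Anisotropic) : q.Nondegenerate := by
  let := invertibleOfNonzero h2
  rw [QuadraticMap.nondegenerate_iff_radical_eq_bot, eq_bot_iff]
  intro x hx
  exact hq x (QuadraticMap.mem_radical_iff'.mp hx).1

theorem QuadraticForm.exists_linearEquiv_comp_eq_weightedSumSquares (h2 : (2 : K) ≠ 0) {n : ℕ}
    (q : QuadraticForm K (Fin n → K)) :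
    ∃ (a : Fin n → K) (e : (Fin n → K) ≃ₗ[K] (Fin n → K)),
      q.comp e.toLinearMap = QuadraticMap.weightedSumSquares K a := by
  let := invertibleOfNonzero h2
  obtain ⟨b, hb⟩ := LinearMap.BilinForm.exists_orthogonal_basis
    (QuadraticForm.associated_isSymm K q)
  let b' := b.reindex (finCongr (Module.finrank_fin_fun K))
  refine ⟨fun k => q (b' k), b'.equivFun.symm, ?_⟩
  refine QuadraticMap.basisRepr_eq_of_iIsOrtho q b' ?_
  intro i j hij
  have := hb (i := (finCongr (Module.finrank_fin_fun K)).symm i)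
    (j := (finCongr (Module.finrank_fin_fun K)).symm j) (by simpa using hij)
  simpa [b', Function.onFun] using this

end LinearAlgebra

/-! ### Descent of the dimension -/

section HassePrinciple

variable {K : Type w} [Field K]

/-- A zero coefficient contributes nothing, so the first summand is already approximately isotropic.
-/
theorem ApproxIsotropic.sumElim_of_zero {v : Valuation K ℤᵐ⁰} {ι : Type*} [Fintype ι] {a : ι → K}
    (h : ApproxIsotropic v (Sum.elim a fun _ : Unit => 0)) (c : K) :
    ApproxIsotropic v (Sum.elim a fun _ : Unit => c) := by
  obtain ⟨x, j, hx⟩ := h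
  rcases j with j | j
  · refine ⟨Sum.elim (fun k => x (Sum.inl k)) 0, Sum.inl j, ?_⟩
    simpa using hx
  · simp at hx

/-- Approximation at finitely many discrete valuations, which are allowed to be equivalent: a
diagonal form that is isotropic over their completions has a nonzero vector `z` in its second
summand such that the first summand together with the value at `z` stays isotropic. -/
theorem exists_ne_zero_forall_approxIsotropic (h2 : (2 : K) ≠ 0) {ι κ : Type*} [Fintype ι]
    [Nonempty ι] [Fintype κ] [Nonempty κ] {a : ι → K} {b : κ → K} (ha : ∀ k, a k ≠ 0)
    (hb : ∀ k, b k ≠ 0) {S : Set (Valuation K ℤᵐ⁰)} (hS : S.Finite)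
    (hnontriv : ∀ v ∈ S, v.IsNontrivial)
    (h : ∀ v ∈ S, ∃ y : ι ⊕ κ → v.Completion, y ≠ 0 ∧
      ∑ k, algebraMap K v.Completion (Sum.elim a b k) * y k ^ 2 = 0) :
    ∃ z : κ → K, z ≠ 0 ∧ ∀ v ∈ S,
      ApproxIsotropic v (Sum.elim a fun _ : Unit => ∑ k, b k * z k ^ 2) := by
  classical
  have := hS.to_subtype
  -- Weak approximation needs pairwise inequivalent valuations, so one representative of each class
  -- is used.
  let equivalence : Setoid S :=
    ⟨fun v v' => v.1.IsEquiv v'.1, ⟨fun _ => .refl, fun h => h.symm, fun h h' => h.trans h'⟩⟩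
  let rep : Quotient equivalence → Valuation K ℤᵐ⁰ := fun t => t.out.1
  have hrepS : ∀ t, rep t ∈ S := fun t => t.out.2
  have hrep : ∀ v (hv : v ∈ S), (rep (Quotient.mk equivalence ⟨v, hv⟩)).IsEquiv v := fun v hv =>
    Quotient.mk_out (s := equivalence) ⟨v, hv⟩
  have hne : Pairwise fun s t => ¬ (rep s).IsEquiv (rep t) := fun s t hst hequiv =>
    hst (Quotient.out_equiv_out.mp hequiv)
  choose y γ hγ0 hγ using fun t => exists_forall_sub_lt_approxIsotropic h2 ha hb (h _ (hrepS t))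
  choose z hz using fun k => Valuation.exists_forall_sub_lt (fun t => hnontriv _ (hrepS t)) hne
    (fun t => y t k) (fun t => hγ0 t k)
  have hzS : ∀ v ∈ S, ApproxIsotropic v (Sum.elim a fun _ : Unit => ∑ k, b k * z k ^ 2) :=
    fun v hv => (hγ _ z fun k => hz k _).of_isEquiv (hrep v hv)
  -- If approximation returns z = 0, the added coefficient was 0 and was not needed, so any nonzero
  -- vector serves.
  by_cases hz0 : z = 0
  · refine ⟨1, one_ne_zero, fun v hv => ApproxIsotropic.sumElim_of_zero ?_ _⟩
    simpa [hz0] using hzS v hv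
  · exact ⟨z, hz0, hzS⟩

/-- Descent of the dimension of forms violating the Hasse principle, for diagonal forms. -/
theorem exists_violatesHassePrinciple_of_diagonal (h2 : (2 : K) ≠ 0)
    {V : Set (Valuation K ℤᵐ⁰)} (hV2 : ∀ v ∈ V, v 2 = 1) (hnontriv : ∀ v ∈ V, v.IsNontrivial)
    (hfin : FiniteSupportProperty V) {N : ℕ} (hK : DiagonalIsotropicAbove K (2 * N))
    {n : ℕ} {a : Fin n → K} (hani : (QuadraticMap.weightedSumSquares K a).Anisotropic)
    (hiso : ∀ v ∈ V, IsIsotropicOver (QuadraticMap.weightedSumSquares K a) v.Completion)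
    {m : ℕ} (hm₁ : N + 2 ≤ m) (hm₂ : m ≤ n) :
    ∃ q : QuadraticForm K (Fin m → K), ViolatesHassePrinciple V q := by
  classical
  have ha : ∀ k, a k ≠ 0 := fun k hk => by
    have := hani (Pi.single k 1) (by
      rw [QuadraticMap.weightedSumSquares_apply]
      refine Finset.sum_eq_zero fun l _ => ?_
      by_cases hl : l = k
      · simp [hl, hk]
      · simp [Pi.single_eq_of_ne hl])
    simpa using congrFun this k
  -- N + 1 is the least dimension to which the argument for unit coefficients applies, given the
  -- bound 2N; the second summand is nonempty since N + 2 ≤ n.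
  let g : Fin (N + 1) ⊕ Fin (n - (N + 1)) ≃ Fin n := Fintype.equivFinOfCardEq (by simp; omega)
  have : Nonempty (Fin (n - (N + 1))) := ⟨⟨0, by omega⟩⟩
  let σ : Fin (N + 1) → K := fun k => a (g (Sum.inl k))
  let ρ : Fin (n - (N + 1)) → K := fun k => a (g (Sum.inr k))
  have hg : ∀ k, Sum.elim σ ρ k = a (g k) := by rintro (k | k) <;> rfl
  have hS : (⋃ k, {v ∈ V | v (σ k) ≠ 1}).Finite := Set.finite_iUnion fun k => hfin _ (ha _)
  have hSV : ∀ v ∈ ⋃ k, {v ∈ V | v (σ k) ≠ 1}, v ∈ V := fun v hv => by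
    obtain ⟨k, hk⟩ := Set.mem_iUnion.mp hv
    exact hk.1
  obtain ⟨z, hz0, hz⟩ := exists_ne_zero_forall_approxIsotropic h2 (a := σ) (b := ρ)
    (fun k => ha _) (fun k => ha _) hS (fun v hv => hnontriv v (hSV v hv)) fun v hv => by
      obtain ⟨y, hy, h0⟩ := (isIsotropicOver_weightedSumSquares_iff _ h2 a).mp (hiso v (hSV v hv))
      refine ⟨fun k => y (g k), fun h => hy ?_, ?_⟩
      · ext k
        simpa using congrFun h (g.symm k)
      · simp only [hg]
        rw [← h0]
        exact Fintype.sum_equiv g _ _ fun _ => rfl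
  set c := ∑ k, ρ k * z k ^ 2 with hc
  have happrox : ∀ v ∈ V, ApproxIsotropic v (Sum.elim σ fun _ : Unit => c) := by
    intro v hv
    by_cases hvS : v ∈ ⋃ k, {v ∈ V | v (σ k) ≠ 1}
    · exact hz v hvS
    · refine (approxIsotropic_of_units (hnontriv v hv) hK (by simp) fun k => ?_).of_injective
        Sum.inl Sum.inl_injective fun k => rfl
      by_contra hk
      exact hvS (Set.mem_iUnion.mpr ⟨k, hv, hk⟩)
  let e : Fin (N + 1) ⊕ Unit ≃ Fin (N + 2) := Fintype.equivFinOfCardEq (by simp)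
  let d : Fin (N + 2) → K := fun k => Sum.elim σ (fun _ => c) (e.symm k)
  have hisod : ∀ v ∈ V, IsIsotropicOver (QuadraticMap.weightedSumSquares K d) v.Completion :=
    fun v hv => (isIsotropicOver_weightedSumSquares_iff _ h2 d).mpr
      (((happrox v hv).of_injective e e.injective fun k => by
        simp [d]).exists_zero_completion (hV2 v hv))
  -- The map (x, t) ↦ (x, tz) realizes σ ⊥ ⟨c⟩ as a subform; it is injective because z ≠ 0.
  let f : (Fin (N + 2) → K) →ₗ[K] (Fin n → K) :=
    { toFun x k := Sum.elim (fun i => x (e (Sum.inl i))) (fun j => x (e (Sum.inr ())) * z j)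
        (g.symm k)
      map_add' x y := by
        ext k
        rcases h : g.symm k with i | j
        · simp [h]
        · simp [h, add_mul]
      map_smul' t x := by
        ext k
        rcases h : g.symm k with i | j
        · simp [h]
        · simp [h, mul_assoc] }
  have hf : Function.Injective f := by
    rw [injective_iff_map_eq_zero]
    intro x hx
    obtain ⟨j, hj⟩ := Function.ne_iff.mp hz0
    have hl : ∀ k, x (e k) = 0 := by
      rintro (i | ⟨⟩)
      · simpa [f] using congrFun hx (g (Sum.inl i))
      · have : x (e (Sum.inr ())) = 0 ∨ z j = 0 := by simpa [f] using congrFun hx (g (Sum.inr j))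
        exact this.resolve_right hj
    ext k
    simpa using hl (e.symm k)
  have hfd : (QuadraticMap.weightedSumSquares K a).comp f =
      QuadraticMap.weightedSumSquares K d := by
    ext x
    rw [QuadraticMap.comp_apply, QuadraticMap.weightedSumSquares_apply,
      QuadraticMap.weightedSumSquares_apply, ← g.sum_comp, ← e.sum_comp]
    simp only [Fintype.sum_sum_type, f, LinearMap.coe_mk, AddHom.coe_mk, Equiv.symm_apply_apply,
      Sum.elim_inl, Sum.elim_inr, d, Finset.univ_unique, Finset.sum_singleton, smul_eq_mul]
    congr 1
    rw [hc, Finset.sum_mul]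
    refine Finset.sum_congr rfl fun k _ => ?_
    simp only [ρ]
    ring_nf
  -- Restrict to an m-dimensional space between the image of `f` and the whole space: anisotropy
  -- comes from above, local isotropy from below.
  obtain ⟨h, g', hh, hg', hcomp⟩ := LinearMap.exists_injective_comp_eq f hf hm₁ hm₂
  have haniq : ((QuadraticMap.weightedSumSquares K a).comp g').Anisotropic := fun x hx =>
    hg' ((hani _ hx).trans (map_zero g').symm)
  refine ⟨(QuadraticMap.weightedSumSquares K a).comp g', haniq.nondegenerate h2, fun v hv => ?_,
    haniq⟩
  refine IsIsotropicOver.of_comp h hh ?_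
  have : ((QuadraticMap.weightedSumSquares K a).comp g').comp h =
      QuadraticMap.weightedSumSquares K d := by
    rw [← hfd, ← hcomp]
    rfl
  rw [this]
  exact hisod v hv

end HassePrinciple

theorem mainTheorem4 {ℓ : Type u} {L : Type w} [Field ℓ] [Field L] [Algebra ℓ L]
    (hchar : ringChar ℓ ≠ 2) (i r : ℕ) (hℓ : PropertyA i ℓ)
    (hfg : (⊤ : IntermediateField ℓ L).FG) (htr : Algebra.trdeg ℓ L = r)
    (hr : 1 ≤ r) (hir : 2 ≤ i + r)
    (V : Set (Valuation L ℤᵐ⁰)) (hV : V.Nonempty)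
    (hnontriv : ∀ v ∈ V, v.IsNontrivial)
    (htriv : ∀ v ∈ V, v.IsTrivialOn ℓ)
    (hdiv : ∀ v ∈ V, IsDivisorial ℓ v)
    (hfin : FiniteSupportProperty V)
    (hviol : ∃ q : QuadraticForm L (Fin (2 ^ (i + r)) → L), ViolatesHassePrinciple V q)
    (m : ℕ) (hm₁ : 2 ^ (i + r - 1) + 2 ≤ m) (hm₂ : m ≤ 2 ^ (i + r)) :
    ∃ q : QuadraticForm L (Fin m → L), ViolatesHassePrinciple V q := by
  have h2ℓ : (2 : ℓ) ≠ 0 := Ring.two_ne_zero hchar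
  have h2 : (2 : L) ≠ 0 := by
    rw [← map_ofNat (algebraMap ℓ L) 2]
    exact (map_ne_zero _).mpr h2ℓ
  have hV2 : ∀ v ∈ V, v 2 = 1 := fun v hv => by
    have := (htriv v hv).eq_one 2 h2ℓ
    rwa [map_ofNat] at this
  have hpow : 2 * 2 ^ (i + r - 1) = 2 ^ (i + r) := by
    rw [← pow_succ']
    congr 1
    omega
  obtain ⟨q, -, hiso, hani⟩ := hviol
  obtain ⟨a, e, he⟩ := QuadraticForm.exists_linearEquiv_comp_eq_weightedSumSquares h2 q
  refine exists_violatesHassePrinciple_of_diagonal h2 hV2 hnontriv hfin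
    (N := 2 ^ (i + r - 1)) (by rw [hpow]; exact hℓ.diagonalIsotropicAbove htr) (a := a) ?_ ?_
    hm₁ hm₂
  · rw [← he]
    exact fun x hx => e.injective ((hani _ hx).trans (map_zero e).symm)
  · intro v hv
    refine IsIsotropicOver.of_comp e.symm.toLinearMap e.symm.injective ?_
    rw [← he]
    convert hiso v hv
    ext x
    simp
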